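/- Let $p$ be an odd prime, $q=p^r$, and let $\mathbb F_q$ be the field with $q$ elements. A linear code $K\subseteq\mathbb F_q^n$ is LCD if $K\cap K^\perp=\{0\}$ for the Euclidean dual $K^\perp$, and MDS if $\dim K+d(K)=n+1$, where $d(K)$ is the minimum Hamming distance and $d(\{0\})=n+1$ by convention. Let $g\in\mathbb F_q[x]$ be monic of degree $n$ with $n$ distinct roots $\alpha_1,\dots,\alpha_n$ in $\mathbb F_q$, and let $a,b\in\mathbb F_q[x]$ be coprime with $\deg a+\deg b\le n$. We say that a code $K$ is *obtained from* $(g;a,b)$ if there are $c\in\mathbb F_q^*$ and $w_1,\dots,w_n\in\mathbb F_q^*$ with $w_i^2=c\,(a\,b\,g')(\alpha_i)$ for all $i$, such that, for some ordering of the roots, $$K=\Big\{\Big(\tfrac{a(\alpha_1)f(\alpha_1)}{w_1},\dots,\tfrac{a(\alpha_n)f(\alpha_n)}{w_n}\Big): f\in\mathbb F_q[x],\ \deg f<n-\deg a\Big\}.$$ (This is the algebraic geometry code $C_L(D,(n-1)P_\infty-A+(w))$ on $\mathbb F_q(x)$, where $D=\sum P_{\alpha_i}$, $A$ is the zero divisor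 of $a$, and $w$ is a function with $w(\alpha_i)=w_i$.) For a subgroup $V\le(\mathbb F_q,+)$ put $g_V=\prod_{\alpha\in V}(x-\alpha)$, and put $N_t=(p^t-1)/(p-1)$. Then for each of the following parameters there is a $q$-ary $[n,k]$ code that is LCD and MDS, given explicitly as follows. 1. $n=p^t$ with $1\le t<r$, and any $0\le k\le n$. The code or its dual is obtained from $(g_V;R^2,1)$ for some $V$ of order $p^t$ and some monic polynomial $R$. 2. $0<n<q$ with $p\mid n$ and $(n-1)\mid(q-1)$, and any $0\le k\le n$. The code is a generalized Reed–Solomon code with evaluation points the roots of $x^n-x$; moreover, if $n$ is odd or $k$ is even, the code or its dual is obtained from $(x^n-x;R^2,1)$ for some monic $R$. 3. $n=p\ell$ with $\ell\mid q-1$ and $p\ell<q$, and $k=2\ell-2m$, where $0\le m\le\ell-1$ if $\ell$ is even and $0\le m\le\ell$ if $\ell$ is odd. The code is obtained from $(f(x^\ell);R^2f'(x^\ell),b)$, where $f=\prod_{i=1}^p(x-\gamma^{i\ell})$ for some primitive element $\gamma$ of $\mathbb F_q$, $R$ is some monic polynomial of degree $m$, and $b=x$ if $\ell$ is even, $b=1$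 if $\ell$ is odd. 4. $q\ge5$ is a square, $n<q$, and $n-1$ is an odd divisor of $q-1$; $k=n-2m$ with $0\le m\le n/2$. The code is obtained from $(x^n-x;(x-\beta)^{2m},(x-\gamma)^{n-2m})$ for some $\beta\ne\gamma$ in $\mathbb F_q$. 5. $n\mid(q-1)/2$ and $1\le m\le n/2$; $k=n-2m$ if $n$ is even, and $k=n-2m-1$ if $n$ is odd. The code is obtained from $(x^n-1;n(x-\beta)^{2m},(x-\gamma)^{n-2m})$ if $n$ is even, and from $(x^n-1;nx(x-\beta)^{2m},(x-\gamma)^{n-1-2m})$ if $n$ is odd, for some $\beta\ne\gamma$ in $\mathbb F_q$. 6. $r>1$, $n=pN_{r-1}$, and any $0\le k\le n$. With $g=((x+1)^{N_r}-1)/x$ and $h=((x+1)^{N_{r-1}}-1)/x$, the code or its dual is obtained from $(g;R^2,xh)$ or from $(g;R^2x,h)$ for some monic $R$. 7. $n=dp^t$ with $t<r$, $1\le d\le p^{r-t}$, $\gcd(d,p)=1$, and $k=dp^t-2m$ with $2\le m\le p^t/2$. The code is obtained from $(f(g_V);R^2,f'(g_V))$, where $V$ is a subgroup of order $p^t$,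 $f=\prod_{i=1}^d(x-g_V(\beta_i))$ for elements $\beta_1,\dots,\beta_d$ in distinct cosets of $V$, and $R$ is some monic polynomial of degree $m$. -/

import Mathlib

open Polynomial

/-- The dual code of a linear code for the Euclidean inner product. -/
def dualCode {F : Type*} [Field F] {n : ℕ} (C : Submodule F (Fin n → F)) :
    Submodule F (Fin n → F) where
  carrier := {x | ∀ c ∈ C, x ⬝ᵥ c = 0}
  add_mem' := by
    intro x y hx hy c hc
    rw [add_dotProduct, hx c hc, hy c hc, add_zero]
  zero_mem' := by
    intro c _
    exact zero_dotProduct c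
  smul_mem' := by
    intro a x hx c hc
    rw [smul_dotProduct, hx c hc, smul_zero]

/-- A linear code is LCD (linear complementary dual) if it meets its dual code in zero only. -/
def IsLCD {F : Type*} [Field F] {n : ℕ} (C : Submodule F (Fin n → F)) : Prop :=
  C ⊓ dualCode C = ⊥

open Classical in
/-- The minimum Hamming distance between distinct codewords. The zero code has no two distinct
codewords; by the usual convention its minimum distance is `n + 1`. -/
noncomputable def minDist {F : Type*} [Field F] {n : ℕ} (C : Submodule F (Fin n → F)) : ℕ :=
  if C = ⊥ then n + 1
  else sInf {d : ℕ | ∃ x ∈ C, ∃ y ∈ C, x ≠ y ∧ hammingDist x y = d}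

/-- A linear code is MDS if its dimension `k` and minimum distance `d` satisfy `k + d = n + 1`. -/
def IsMDS {F : Type*} [Field F] {n : ℕ} (C : Submodule F (Fin n → F)) : Prop :=
  Module.finrank F C + minDist C = n + 1

/-- `C` is an `[n, k]` LCD MDS code. -/
def IsLCDMDS {F : Type*} [Field F] {n : ℕ} (k : ℕ) (C : Submodule F (Fin n → F)) : Prop :=
  Module.finrank F C = k ∧ IsLCD C ∧ IsMDS C

/-- The generalized Reed-Solomon code of all `(v₁ f(α₁), …, vₙ f(αₙ))` with `deg f < k`. -/
noncomputable def grsCode {F : Type*} [Field F] {n : ℕ} (α v : Fin n → F) (k : ℕ) :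
    Submodule F (Fin n → F) :=
  (degreeLT F k).map (LinearMap.pi fun i => v i • leval (α i))

/-- `α` lists, without repetition, the roots of the polynomial `g`, which is monic of degree `n`
with `n` distinct roots in `F`. -/
def ListsRoots {F : Type*} [Field F] {n : ℕ} (α : Fin n → F) (g : F[X]) : Prop :=
  Function.Injective α ∧ ∏ i, (X - C (α i)) = g

/-- `K` is the code of length `n` obtained from the polynomials `g`, `a`, `b`, as follows.
Let `D` be the sum of the zeros `α₁, …, αₙ` of `g` (assumed simple and rational), let `A` be the
zero divisor of `a`, let `z = g'`, and let `w` be a function with `w² = c a b z` at all `αᵢ`, for a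
nonzero constant `c`. Then `K` is the functional code of the divisor `(n - 1) P_∞ - A + (w)` on
`D`, that is, the code of all `(a f / w)(αᵢ)` with `f` a polynomial of degree `< n - deg a`.
It is required that `a`, `b` are coprime, that they do not vanish at the `αᵢ`, and that
`deg a + deg b ≤ n`. -/
def IsObtainedFrom {F : Type*} [Field F] {n : ℕ} (g a b : F[X])
    (K : Submodule F (Fin n → F)) : Prop :=
  IsCoprime a b ∧ a.natDegree + b.natDegree ≤ n ∧
    ∃ α : Fin n → F, ListsRoots α g ∧
      ∃ (c : F) (w : Fin n → F), c ≠ 0 ∧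
        (∀ i, w i ≠ 0 ∧ w i ^ 2 = c * (a * b * derivative g).eval (α i)) ∧
        K = grsCode α (fun i => a.eval (α i) / w i) (n - a.natDegree)

/-- `K` or its dual code is obtained from `g`, `a`, `b`. -/
def IsObtainedUpToDual {F : Type*} [Field F] {n : ℕ} (g a b : F[X])
    (K : Submodule F (Fin n → F)) : Prop :=
  IsObtainedFrom g a b K ∨ IsObtainedFrom g a b (dualCode K)

open Classical in
/-- The polynomial `∏ (x - α)` over all `α` in `V`. (The additive subgroups of `F` of order `p ^ t`
are the subspaces of dimension `t` over the prime field.) -/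
noncomputable def subspacePoly {F : Type*} [Field F] [Fintype F] (V : AddSubgroup F) : F[X] :=
  ∏ x ∈ Finset.univ.filter (fun x : F => x ∈ V), (X - C x)

/-- `N_t = (p ^ t - 1) / (p - 1)`; the division is exact. -/
def repNum (p t : ℕ) : ℕ := (p ^ t - 1) / (p - 1)

/-- The polynomial `((x + 1) ^ N - 1) / x`; the division is exact. -/
noncomputable def shiftedRootPoly (F : Type*) [Field F] (N : ℕ) : F[X] :=
  ((X + 1) ^ N - 1 : F[X]).divX

/-- The polynomial `∏_{i = 1}^{p} (x - γ ^ (i ℓ))`. -/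
noncomputable def cosetPoly {F : Type*} [Field F] (p ℓ : ℕ) (γ : F) : F[X] :=
  ∏ i ∈ Finset.Icc 1 p, (X - C (γ ^ (i * ℓ)))

/-! ### Generalized Reed–Solomon codes: parameters, duality, and the LCD criterion. -/

section Codes

variable {F : Type*} [Field F] {n : ℕ}

/-! By Lagrange interpolation, the sum of `P / g'` over the roots of `g` is the coefficient of
`x^(n-1)` in `P` when `deg P < n`. Since `w² = c a b g'` at the roots, the dual of the code of all
`a f / w` with `deg f < n - deg a` is the code of all `b h / w` with `deg h < deg a`. A common word
gives `a f = b h` at all `n` roots, hence as polynomials because both degrees are below `n`.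
Coprimality then gives `a ∣ h`, so `h = 0`. Thus both codes are LCD, and they are MDS as generalized
Reed–Solomon codes (`isObtainedFrom_spec`).

It remains to find, in each family, coprime `a` and `b` of small degree such that `c a b g'` is a
nonzero square at every root of `g` (`exists_isObtainedFrom`). The reasons differ. Families 1 and 2:
`g'` is constant on the roots, because a subspace polynomial is additive, respectively because `p ∣
n`. Families 3 and 7: `g` is a composition, and by the chain rule the factor `f'(x^ℓ)` or `f'(g_V)`
of `g'` is paired with an equal factor of `a` or `b`. Family 4: `g'` takes values in the prime
field, all of whose elements are squares in a field of square order. Family 5: the roots of `x^n -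
1` are themselves squares. Family 6: an identity from the Frobenius makes `-x h g'` a square at the
roots (`exists_sq_eq_shiftedRootPoly`).

One case escapes this scheme: in family 2, `n` even and `k` odd. There the column multipliers are
chosen one at a time so that a bilinear form stays nondegenerate (`exists_nondegenerateWeights`). -/

theorem mem_grsCode {α v : Fin n → F} {k : ℕ} {x : Fin n → F} :
    x ∈ grsCode α v k ↔ ∃ f : F[X], f.degree < k ∧ ∀ i, x i = v i * f.eval (α i) := by
  simp only [grsCode, Submodule.mem_map, mem_degreeLT]
  refine exists_congr fun f => and_congr_right fun _ => ?_
  simp [funext_iff, leval, eq_comm]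

theorem mem_dualCode {C : Submodule F (Fin n → F)} {x : Fin n → F} :
    x ∈ dualCode C ↔ ∀ c ∈ C, x ⬝ᵥ c = 0 := Iff.rfl

theorem eq_zero_of_degree_lt_of_eval_eq_zero {α : Fin n → F} (hα : Function.Injective α)
    {f : F[X]} (hf : f.degree < n) (h : ∀ i, f.eval (α i) = 0) : f = 0 :=
  eq_zero_of_degree_lt_of_eval_index_eq_zero Finset.univ
    (hα.injOn (s := _)) (by simpa using hf) fun i _ => h i

theorem finrank_grsCode {α v : Fin n → F} (hα : Function.Injective α) (hv : ∀ i, v i ≠ 0)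
    {k : ℕ} (hk : k ≤ n) : Module.finrank F (grsCode α v k) = k := by
  set L : F[X] →ₗ[F] (Fin n → F) := LinearMap.pi fun i => v i • leval (α i) with hL
  have hinj : Function.Injective (L.domRestrict (degreeLT F k)) := by
    rw [← LinearMap.ker_eq_bot, LinearMap.ker_eq_bot']
    rintro ⟨f, hf⟩ h
    rw [mem_degreeLT] at hf
    refine Subtype.ext (eq_zero_of_degree_lt_of_eval_eq_zero hα
      (hf.trans_le (by exact_mod_cast hk)) fun i => ?_)
    have := congrFun h i
    simpa [hL, leval, hv i] using this
  have h1 := LinearMap.finrank_range_of_inj hinj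
  rw [LinearMap.range_domRestrict, (degreeLTEquiv F k).finrank_eq] at h1
  rw [Module.finrank_fin_fun] at h1
  exact h1

theorem grsCode_zero (α v : Fin n → F) : grsCode α v 0 = ⊥ := by
  rw [eq_bot_iff]
  intro x hx
  obtain ⟨f, hf, hx⟩ := mem_grsCode.1 hx
  have : f = 0 := by simpa using hf
  ext i
  simp [hx i, this]

theorem card_filter_eval_eq_zero_le {α : Fin n → F} (hα : Function.Injective α) {f : F[X]}
    (hf : f ≠ 0) [DecidablePred fun i => f.eval (α i) = 0] :
    (Finset.univ.filter fun i => f.eval (α i) = 0).card ≤ f.natDegree := by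
  classical
  rw [← Finset.card_image_of_injective _ hα]
  refine (Finset.card_le_card ?_).trans ((Multiset.toFinset_card_le _).trans (card_roots' f))
  intro x hx
  obtain ⟨i, hi, rfl⟩ := Finset.mem_image.1 hx
  simpa [hf] using hi

theorem minDist_grsCode {α v : Fin n → F} (hα : Function.Injective α) (hv : ∀ i, v i ≠ 0)
    {k : ℕ} (hk : k ≤ n) : minDist (grsCode α v k) = n + 1 - k := by
  classical
  rcases Nat.eq_zero_or_pos k with rfl | hk0
  · simp [minDist, grsCode_zero]
  have hne : grsCode α v k ≠ ⊥ := by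
    intro h
    have := finrank_grsCode hα hv hk
    rw [h, finrank_bot] at this
    omega
  rw [minDist, if_neg hne]
  have hcompl : ∀ x y : Fin n → F, hammingDist x y =
      n - (Finset.univ.filter fun i => x i = y i).card := by
    intro x y
    have := Finset.card_filter_add_card_filter_not (s := (Finset.univ : Finset (Fin n)))
      (fun i => x i = y i)
    rw [Finset.card_univ, Fintype.card_fin] at this
    refine Nat.eq_sub_of_add_eq' (Eq.trans ?_ this)
    simp [hammingDist]
  refine IsLeast.csInf_eq ⟨?_, ?_⟩
  -- A polynomial of degree `k - 1` vanishing at `k - 1` of the points gives a word of minimum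
  -- weight.
  · set s : Finset (Fin n) := Finset.univ.filter fun i => (i : ℕ) < k - 1 with hs
    have hscard : s.card = k - 1 := by
      rw [hs, Fin.card_filter_val_lt]
      omega
    set f : F[X] := ∏ i ∈ s, (X - C (α i)) with hf
    have hdeg : f.degree = (k - 1 : ℕ) := by
      rw [hf, degree_prod]
      simp [hscard]
    have hroot : ∀ i, f.eval (α i) = 0 ↔ i ∈ s := by
      intro i
      simp [hf, eval_prod, Finset.prod_eq_zero_iff, sub_eq_zero, hα.eq_iff]
    have hx : (fun i => v i * f.eval (α i)) ∈ grsCode α v k :=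
      mem_grsCode.2 ⟨f, by rw [hdeg]; exact_mod_cast (by omega), fun _ => rfl⟩
    have hfilter : (Finset.univ.filter fun i => v i * f.eval (α i) = (0 : Fin n → F) i) = s := by
      ext i
      simp [hv i, hroot]
    have hd : hammingDist (fun i => v i * f.eval (α i)) 0 = n + 1 - k := by
      rw [hcompl, hfilter, hscard]
      omega
    refine ⟨_, hx, 0, Submodule.zero_mem _, ?_, hd⟩
    intro h0
    rw [h0, hammingDist_self] at hd
    omega
  · rintro d ⟨x, hx, y, hy, hxy, rfl⟩
    obtain ⟨f, hf, hxf⟩ := mem_grsCode.1 hx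
    obtain ⟨h, hh, hyh⟩ := mem_grsCode.1 hy
    have hfh : f - h ≠ 0 := by
      intro h0
      rw [sub_eq_zero] at h0
      exact hxy (funext fun i => by rw [hxf, hyh, h0])
    have hdeg : (f - h).natDegree < k := by
      rw [natDegree_lt_iff_degree_lt hfh]
      exact (degree_sub_le _ _).trans_lt (max_lt hf hh)
    have h1 := card_filter_eval_eq_zero_le hα hfh
    have h2 : (Finset.univ.filter fun i => x i = y i) =
        Finset.univ.filter fun i => (f - h).eval (α i) = 0 := by
      ext i
      simp [hxf, hyh, hv i, sub_eq_zero]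
    rw [hcompl, h2]
    omega

theorem isMDS_grsCode {α v : Fin n → F} (hα : Function.Injective α) (hv : ∀ i, v i ≠ 0)
    {k : ℕ} (hk : k ≤ n) : IsMDS (grsCode α v k) := by
  rw [IsMDS, finrank_grsCode hα hv hk, minDist_grsCode hα hv hk]
  omega

/-- Compare leading coefficients in Lagrange's interpolation formula, whose denominators are the
values of `g'` at the nodes. -/
theorem ListsRoots.sum_eval_div_derivative {α : Fin n → F} {g : F[X]} (hα : ListsRoots α g)
    {P : F[X]} (hP : P.degree < n) :
    ∑ i, P.eval (α i) / (derivative g).eval (α i) = P.coeff (n - 1) := by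
  classical
  have h := Lagrange.coeff_eq_sum (s := Finset.univ) (v := α) hα.1.injOn (P := P) (by simpa using hP)
  rw [Finset.card_univ, Fintype.card_fin] at h
  rw [h]
  refine Finset.sum_congr rfl fun i _ => ?_
  rw [← hα.2, ← Lagrange.nodal_eq, Lagrange.eval_nodal_derivative_eval_node_eq (Finset.mem_univ i),
    Lagrange.eval_nodal]

theorem ListsRoots.eval_derivative_ne_zero {α : Fin n → F} {g : F[X]} (hα : ListsRoots α g)
    (i : Fin n) : (derivative g).eval (α i) ≠ 0 := by
  classical
  rw [← hα.2, ← Lagrange.nodal_eq, Lagrange.eval_nodal_derivative_eval_node_eq (Finset.mem_univ i),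
    Lagrange.eval_nodal, Finset.prod_ne_zero_iff]
  intro j hj
  exact sub_ne_zero.2 fun h => (Finset.mem_erase.1 hj).1 (hα.1 h).symm

theorem ListsRoots.eval_eq_zero {α : Fin n → F} {g : F[X]} (hα : ListsRoots α g)
    (i : Fin n) : g.eval (α i) = 0 := by
  rw [← hα.2, eval_prod]
  exact Finset.prod_eq_zero (Finset.mem_univ i) (by simp)

/-- When `deg (f h) < n`, the inner product of the words of `f` and `h` is `e` times the coefficient
of `x^(n-1)` in `f h`, so it vanishes if `deg f + deg h < n - 1`. -/
theorem dualCode_grsCode {α u v : Fin n → F} {g : F[X]} (hα : ListsRoots α g) {e : F}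
    (he : e ≠ 0) (huv : ∀ i, u i * v i * (derivative g).eval (α i) = e) {k : ℕ} (hk : k ≤ n) :
    dualCode (grsCode α v k) = grsCode α u (n - k) := by
  have hu : ∀ i, u i ≠ 0 := fun i h => he (by rw [← huv i, h]; ring)
  have key : ∀ f h : F[X], (f * h).degree < n →
      (fun i => u i * h.eval (α i)) ⬝ᵥ (fun i => v i * f.eval (α i)) =
        e * (f * h).coeff (n - 1) := by
    intro f h hd
    rw [← hα.sum_eval_div_derivative hd, Finset.mul_sum]
    refine Finset.sum_congr rfl fun i _ => ?_
    rw [mul_div_assoc', eq_div_iff (hα.eval_derivative_ne_zero i), ← huv i, eval_mul]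
    ring
  ext x
  constructor
  · intro hx
    set h := Lagrange.interpolate Finset.univ α (fun i => x i / u i) with hh
    have hdeg : h.degree < n := by
      have := Lagrange.degree_interpolate_lt (s := Finset.univ) (fun i => x i / u i) hα.1.injOn
      rwa [Finset.card_univ, Fintype.card_fin] at this
    have hxh : ∀ i, x i = u i * h.eval (α i) := by
      intro i
      rw [hh, Lagrange.eval_interpolate_at_node _ hα.1.injOn (Finset.mem_univ i),
        mul_div_cancel₀ _ (hu i)]
    refine mem_grsCode.2 ⟨h, ?_, hxh⟩
    by_contra hcon
    have h0 : h ≠ 0 := by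
      rintro h0
      rw [h0, degree_zero] at hcon
      exact hcon (WithBot.bot_lt_coe _)
    rw [degree_eq_natDegree h0] at hcon hdeg
    have h1 : h.natDegree < n := by exact_mod_cast hdeg
    have h2 : n - k ≤ h.natDegree := by
      rw [not_lt] at hcon
      exact_mod_cast hcon
    -- If `deg h ≥ n - k`, this monomial has degree below `k` and moves the leading coefficient of
    -- `h` to position `n - 1`, contradicting orthogonality.
    have h3 := key (X ^ (n - 1 - h.natDegree)) h (by
      rw [degree_mul, degree_X_pow, degree_eq_natDegree h0]
      exact_mod_cast (by omega))
    have h4 : (fun i => v i * (X ^ (n - 1 - h.natDegree) : F[X]).eval (α i)) ∈ grsCode α v k :=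
      mem_grsCode.2 ⟨_, by rw [degree_X_pow]; exact_mod_cast (by omega), fun _ => rfl⟩
    have h5 := mem_dualCode.1 hx _ h4
    rw [show x = fun i => u i * h.eval (α i) from funext hxh, h3] at h5
    have h6 : (X ^ (n - 1 - h.natDegree) * h).coeff (n - 1) = h.leadingCoeff := by
      rw [coeff_X_pow_mul', if_pos (by omega), leadingCoeff]
      congr 1
      omega
    rw [h6] at h5
    exact (mul_ne_zero he (leadingCoeff_ne_zero.2 h0)) h5
  · intro hx c hc
    obtain ⟨h, hh, hxh⟩ := mem_grsCode.1 hx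
    obtain ⟨f, hf, hcf⟩ := mem_grsCode.1 hc
    rw [show x = fun i => u i * h.eval (α i) from funext hxh,
      show c = fun i => v i * f.eval (α i) from funext hcf]
    by_cases h0 : f * h = 0
    · rw [key f h (by rw [h0, degree_zero]; exact WithBot.bot_lt_coe _), h0]
      simp
    have hf0 := left_ne_zero_of_mul h0
    have hh0 := right_ne_zero_of_mul h0
    rw [← natDegree_lt_iff_degree_lt hf0] at hf
    rw [← natDegree_lt_iff_degree_lt hh0] at hh
    have hlt : (f * h).natDegree < n - 1 := by
      rw [natDegree_mul hf0 hh0]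
      omega
    rw [key f h ((natDegree_lt_iff_degree_lt h0).1 (by omega)), coeff_eq_zero_of_natDegree_lt hlt,
      mul_zero]

theorem isObtainedFrom_spec {g a b : F[X]} {K : Submodule F (Fin n → F)}
    (h : IsObtainedFrom g a b K) :
    IsLCDMDS (n - a.natDegree) K ∧ IsLCDMDS a.natDegree (dualCode K) ∧
      dualCode (dualCode K) = K ∧
      (∃ α v : Fin n → F, ListsRoots α g ∧ (∀ i, v i ≠ 0) ∧ K = grsCode α v (n - a.natDegree)) ∧
      (∃ α v : Fin n → F, ListsRoots α g ∧ (∀ i, v i ≠ 0) ∧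
        dualCode K = grsCode α v a.natDegree) := by
  obtain ⟨hab, hdeg, α, hα, c, w, hc, hw, rfl⟩ := h
  have hne : ∀ i, a.eval (α i) ≠ 0 ∧ b.eval (α i) ≠ 0 := by
    intro i
    have h1 : c * (a * b * derivative g).eval (α i) ≠ 0 := by
      rw [← (hw i).2]
      exact pow_ne_zero 2 (hw i).1
    constructor <;> intro h0 <;> apply h1 <;> simp [h0]
  set v : Fin n → F := fun i => a.eval (α i) / w i with hv
  set u : Fin n → F := fun i => b.eval (α i) / w i with hu
  have hv0 : ∀ i, v i ≠ 0 := fun i => div_ne_zero (hne i).1 (hw i).1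
  have hu0 : ∀ i, u i ≠ 0 := fun i => div_ne_zero (hne i).2 (hw i).1
  have huv : ∀ i, u i * v i * (derivative g).eval (α i) = c⁻¹ := by
    intro i
    have h1 := (hw i).2
    have h2 := (hw i).1
    simp only [eval_mul] at h1
    simp only [hu, hv]
    field_simp
    rw [h1]
    ring
  have hvu : ∀ i, v i * u i * (derivative g).eval (α i) = c⁻¹ := fun i => by
    rw [mul_comm (v i), huv]
  have hle : a.natDegree ≤ n := by omega
  have hsub : n - (n - a.natDegree) = a.natDegree := by omega
  have hdual : dualCode (grsCode α v (n - a.natDegree)) = grsCode α u a.natDegree := by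
    rw [dualCode_grsCode hα (inv_ne_zero hc) huv (Nat.sub_le _ _), hsub]
  have hdual' : dualCode (grsCode α u a.natDegree) = grsCode α v (n - a.natDegree) :=
    dualCode_grsCode hα (inv_ne_zero hc) hvu hle
  have hlcd : grsCode α v (n - a.natDegree) ⊓ grsCode α u a.natDegree = ⊥ := by
    rw [eq_bot_iff]
    rintro x ⟨hx1, hx2⟩
    obtain ⟨f, hf, hxf⟩ := mem_grsCode.1 hx1
    obtain ⟨h, hh, hxh⟩ := mem_grsCode.1 hx2
    -- For `n = 0` there is no root at which to see that `a` and `b` are nonzero.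
    rcases Nat.eq_zero_or_pos n with rfl | hn
    · exact Subsingleton.elim _ _
    have ha0 : a ≠ 0 := by
      rintro rfl
      exact (hne ⟨0, hn⟩).1 (by simp)
    have hb0 : b ≠ 0 := by
      rintro rfl
      exact (hne ⟨0, hn⟩).2 (by simp)
    have hd1 : (a * f).degree < n := by
      by_cases hf0 : f = 0
      · rw [hf0, mul_zero, degree_zero]
        exact WithBot.bot_lt_coe _
      rw [← natDegree_lt_iff_degree_lt hf0] at hf
      rw [← natDegree_lt_iff_degree_lt (mul_ne_zero ha0 hf0), natDegree_mul ha0 hf0]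
      omega
    have hd2 : (b * h).degree < n := by
      by_cases hh0 : h = 0
      · rw [hh0, mul_zero, degree_zero]
        exact WithBot.bot_lt_coe _
      rw [← natDegree_lt_iff_degree_lt hh0] at hh
      rw [← natDegree_lt_iff_degree_lt (mul_ne_zero hb0 hh0), natDegree_mul hb0 hh0]
      omega
    have heq : a * f - b * h = 0 := by
      refine eq_zero_of_degree_lt_of_eval_eq_zero hα.1
        ((degree_sub_le _ _).trans_lt (max_lt hd1 hd2)) fun i => ?_
      have h1 := (hxf i).symm.trans (hxh i)
      have h2 := (hw i).1
      simp only [hu, hv] at h1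
      field_simp at h1
      simp [h1]
    have hdvd : a ∣ b * h := ⟨f, (sub_eq_zero.1 heq).symm⟩
    have hh0 : h = 0 := by
      by_contra hh0
      rw [← natDegree_lt_iff_degree_lt hh0] at hh
      exact absurd (natDegree_le_of_dvd (hab.dvd_of_dvd_mul_left hdvd) hh0) (by omega)
    have : x = 0 := by
      ext i
      simp [hxh i, hh0]
    simp [this]
  refine ⟨⟨finrank_grsCode hα.1 hv0 (Nat.sub_le _ _), ?_, isMDS_grsCode hα.1 hv0 (Nat.sub_le _ _)⟩,
    ?_, ?_, ⟨α, v, hα, hv0, rfl⟩, ⟨α, u, hα, hu0, hdual⟩⟩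
  · rw [IsLCD, hdual, hlcd]
  · rw [hdual]
    refine ⟨finrank_grsCode hα.1 hu0 hle, ?_, isMDS_grsCode hα.1 hu0 hle⟩
    rw [IsLCD, hdual', inf_comm, hlcd]
  · rw [hdual, hdual']

theorem exists_isObtainedFrom {g a b : F[X]} (hg : ∃ α : Fin n → F, ListsRoots α g)
    (hab : IsCoprime a b) (hdeg : a.natDegree + b.natDegree ≤ n) {c : F} (hc : c ≠ 0)
    (hsq : ∀ x, g.eval x = 0 → (derivative g).eval x ≠ 0 →
      ∃ s : F, s ≠ 0 ∧ s ^ 2 = c * (a * b * derivative g).eval x) :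
    ∃ K : Submodule F (Fin n → F), IsObtainedFrom g a b K := by
  obtain ⟨α, hα⟩ := hg
  choose w hw using fun i => hsq (α i) (hα.eval_eq_zero i) (hα.eval_derivative_ne_zero i)
  exact ⟨_, hab, hdeg, α, hα, c, w, hc, hw, rfl⟩

end Codes

/-! ### LCD codes with multipliers chosen from two values. -/

section Hull

variable {F : Type*} [Field F] {n : ℕ}

/-- The symmetric form with diagonal weights `y` is nondegenerate on the polynomials of degree
less than `k`, evaluated at `α`. -/
def NondegenerateWeights (α : Fin n → F) (k : ℕ) (y : Fin n → F) : Prop :=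
  ∀ f : F[X], f.degree < k →
    (∀ h : F[X], h.degree < k → ∑ i, y i * f.eval (α i) * h.eval (α i) = 0) → f = 0

/-- The Gram determinant is affine in the weight at `j`, and not identically zero, so it has at most
one zero. The argument avoids determinants: let `f` and `h` be radical vectors for the weights `s`
and `t`. Neither vanishes at `α j`, since otherwise it would be radical for `z`. Subtracting the two
evaluations of the pairing of `f` with `h` gives `(s - t) f(α j) h(α j) = 0`. -/
theorem NondegenerateWeights.update {α : Fin n → F} {k : ℕ} {z : Fin n → F}
    (hz : NondegenerateWeights α k z) (j : Fin n) {s t : F} (hst : s ≠ t) :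
    NondegenerateWeights α k (Function.update z j s) ∨
      NondegenerateWeights α k (Function.update z j t) := by
  have hsum : ∀ (s : F) (f h : F[X]),
      ∑ i, Function.update z j s i * f.eval (α i) * h.eval (α i) =
        ∑ i, z i * f.eval (α i) * h.eval (α i) + (s - z j) * f.eval (α j) * h.eval (α j) := by
    intro s f h
    rw [← Finset.add_sum_erase _ _ (Finset.mem_univ j),
      ← Finset.add_sum_erase _ (fun i => z i * f.eval (α i) * h.eval (α i)) (Finset.mem_univ j),
      Function.update_self]
    have : ∑ i ∈ Finset.univ.erase j, Function.update z j s i * f.eval (α i) * h.eval (α i) =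
        ∑ i ∈ Finset.univ.erase j, z i * f.eval (α i) * h.eval (α i) :=
      Finset.sum_congr rfl fun i hi => by
        rw [Function.update_of_ne (Finset.ne_of_mem_erase hi)]
    rw [this]
    ring
  by_contra hcon
  push Not at hcon
  obtain ⟨h1, h2⟩ := hcon
  simp only [NondegenerateWeights, not_forall] at h1 h2
  obtain ⟨f, hf, hf', hf0⟩ := h1
  obtain ⟨h, hh, hh', hh0⟩ := h2
  have hfj : f.eval (α j) ≠ 0 := fun h0 => hf0 (hz f hf fun q hq => by
    have := hf' q hq
    rwa [hsum, h0, mul_zero, zero_mul, add_zero] at this)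
  have hhj : h.eval (α j) ≠ 0 := fun h0 => hh0 (hz h hh fun q hq => by
    have := hh' q hq
    rwa [hsum, h0, mul_zero, zero_mul, add_zero] at this)
  have e1 := hf' h hh
  have e2 := hh' f hf
  rw [hsum] at e1 e2
  have e3 : ∑ i, z i * f.eval (α i) * h.eval (α i) = ∑ i, z i * h.eval (α i) * f.eval (α i) :=
    Finset.sum_congr rfl fun i _ => by ring
  have e4 : (s - t) * (f.eval (α j) * h.eval (α j)) = 0 := by
    linear_combination e1 - e2 - e3
  exact mul_ne_zero (sub_ne_zero.2 hst) (mul_ne_zero hfj hhj) e4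

/-- Starting point of the induction: evaluation at the first `k` points turns the form into the
standard one, and pairing with a Lagrange basis polynomial isolates one value of `f`. -/
theorem nondegenerateWeights_indicator {α : Fin n → F} (hα : Function.Injective α) {k : ℕ}
    (hk : k ≤ n) : NondegenerateWeights α k fun i => if (i : ℕ) < k then 1 else 0 := by
  classical
  intro f hf h
  set s : Finset (Fin n) := Finset.univ.filter fun i => (i : ℕ) < k with hs
  have hscard : s.card = k := by
    rw [hs, Fin.card_filter_val_lt]
    omega
  refine eq_zero_of_degree_lt_of_eval_index_eq_zero s hα.injOn
    (by rwa [hscard]) fun j hj => ?_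
  have hq := h (Lagrange.basis s α j) (by
    rw [Lagrange.degree_basis hα.injOn hj, hscard]
    have : 0 < k := by
      rw [← hscard]
      exact Finset.card_pos.2 ⟨j, hj⟩
    exact_mod_cast (by omega))
  rw [Finset.sum_eq_single j] at hq
  · rw [Lagrange.eval_basis_self hα.injOn hj] at hq
    simpa [(Finset.mem_filter.1 hj).2] using hq
  · intro i _ hij
    by_cases hi : i ∈ s
    · rw [Lagrange.eval_basis_of_ne hij.symm hi, mul_zero]
    · have : ¬ (i : ℕ) < k := fun h => hi (by simp [hs, h])
      simp [this]
  · intro h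
    exact absurd (Finset.mem_univ j) h

theorem exists_nondegenerateWeights {α : Fin n → F} (hα : Function.Injective α) {k : ℕ}
    (hk : k ≤ n) {s t : F} (hst : s ≠ t) :
    ∃ y : Fin n → F, (∀ i, y i = s ∨ y i = t) ∧ NondegenerateWeights α k y := by
  suffices h : ∀ S : Finset (Fin n), ∃ y : Fin n → F, (∀ i ∈ S, y i = s ∨ y i = t) ∧
      NondegenerateWeights α k y by
    obtain ⟨y, hy, hy'⟩ := h Finset.univ
    exact ⟨y, fun i => hy i (Finset.mem_univ i), hy'⟩
  intro S
  induction S using Finset.induction_on with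
  | empty => exact ⟨_, by simp, nondegenerateWeights_indicator hα hk⟩
  | insert j S hj ih =>
    obtain ⟨y, hy, hy'⟩ := ih
    have aux : ∀ e, e = s ∨ e = t → ∀ i ∈ insert j S,
        Function.update y j e i = s ∨ Function.update y j e i = t := by
      intro e he i hi
      by_cases hij : i = j
      · subst hij
        simpa using he
      · rw [Function.update_of_ne hij]
        exact hy i (Finset.mem_of_mem_insert_of_ne hi hij)
    rcases hy'.update j hst with h | h
    · exact ⟨_, aux s (Or.inl rfl), h⟩
    · exact ⟨_, aux t (Or.inr rfl), h⟩

theorem isLCD_grsCode {α v : Fin n → F} {k : ℕ}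
    (h : NondegenerateWeights α k fun i => v i ^ 2) : IsLCD (grsCode α v k) := by
  rw [IsLCD, eq_bot_iff]
  rintro x ⟨hx, hx'⟩
  obtain ⟨f, hf, hxf⟩ := mem_grsCode.1 hx
  have hf0 : f = 0 := h f hf fun q hq => by
    have := hx' (fun i => v i * q.eval (α i)) (mem_grsCode.2 ⟨q, hq, fun _ => rfl⟩)
    rw [← this]
    exact Finset.sum_congr rfl fun i _ => by rw [hxf]; ring
  have : x = 0 := by
    ext i
    simp [hxf i, hf0]
  simp [this]

/-- The weights of the form are the squared multipliers, so the two admissible values must be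
distinct nonzero squares: `s ^ 2` and `1`. -/
theorem exists_isLCDMDS_grsCode {α : Fin n → F} (hα : Function.Injective α) {k : ℕ} (hk : k ≤ n)
    {s : F} (hs : s ≠ 0) (hs' : s ^ 2 ≠ 1) :
    ∃ v : Fin n → F, (∀ i, v i ≠ 0) ∧ IsLCDMDS k (grsCode α v k) := by
  obtain ⟨y, hy, hy'⟩ := exists_nondegenerateWeights hα hk hs'
  have : ∀ i, ∃ e : F, e ≠ 0 ∧ e ^ 2 = y i := by
    intro i
    rcases hy i with h | h
    · exact ⟨s, hs, h.symm⟩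
    · exact ⟨1, one_ne_zero, by rw [h, one_pow]⟩
  choose v hv hv' using this
  refine ⟨v, hv, finrank_grsCode hα hv hk, isLCD_grsCode ?_, isMDS_grsCode hα hv hk⟩
  rwa [show (fun i => v i ^ 2) = y from funext hv']

end Hull

/-! ### Root sets, and the case of constant derivative. -/

section Roots

variable {F : Type*} [Field F] {n : ℕ}

theorem exists_listsRoots_prod (S : Finset F) (hS : S.card = n) :
    ∃ α : Fin n → F, ListsRoots α (∏ x ∈ S, (X - C x)) := by
  let e := S.equivFinOfCardEq hS
  refine ⟨fun i => e.symm i, Subtype.val_injective.comp e.symm.injective, ?_⟩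
  exact (e.symm.prod_comp fun x : S => (X - C (x : F))).trans 
    (Finset.prod_coe_sort S fun x => X - C x)

theorem isCoprime_X_sub_C_pow {b : F[X]} {β : F} (h : b.eval β ≠ 0) (m : ℕ) :
    IsCoprime ((X - C β) ^ m) b := by
  refine IsCoprime.pow_left ?_
  rw [(irreducible_X_sub_C β).coprime_iff_not_dvd, dvd_iff_isRoot]
  exact h

/-- With `a = (x - β)^(2m)`, `b = 1` and `c = e⁻¹`, the value to be a square is `(x - β)^(2m)`.
Duals give the even dimensions `2m`, the codes themselves give `n - 2m`, which is odd when `n` is.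
-/
theorem exists_isLCDMDS_of_derivative_const {g : F[X]} (hg : ∃ α : Fin n → F, ListsRoots α g)
    {e β : F} (he : e ≠ 0) (hg' : ∀ x, g.eval x = 0 → (derivative g).eval x = e)
    (hβ : g.eval β ≠ 0) {k : ℕ} (hk : k ≤ n) (hpar : Odd n ∨ Even k) :
    ∃ K : Submodule F (Fin n → F), IsLCDMDS k K ∧
      (∃ α v : Fin n → F, ListsRoots α g ∧ (∀ i, v i ≠ 0) ∧ K = grsCode α v k) ∧
      ∃ R : F[X], R.Monic ∧ IsObtainedUpToDual g (R ^ 2) 1 K := by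
  have key : ∀ m, 2 * m ≤ n → ∃ K : Submodule F (Fin n → F),
      IsObtainedFrom g (((X - C β) ^ m) ^ 2) 1 K := by
    intro m hm
    refine exists_isObtainedFrom hg isCoprime_one_right ?_ (inv_ne_zero he) ?_
    · rw [natDegree_pow, natDegree_pow, natDegree_X_sub_C, natDegree_one]
      omega
    · intro x hx _
      refine ⟨(x - β) ^ m, pow_ne_zero _ (sub_ne_zero.2 ?_), ?_⟩
      · rintro rfl
        exact hβ hx
      · simp [hg' x hx]
        field_simp
  have hdeg : ∀ m, (((X - C β) ^ m) ^ 2 : F[X]).natDegree = 2 * m := by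
    intro m
    rw [natDegree_pow, natDegree_pow, natDegree_X_sub_C, mul_one]
  have hmonic : ∀ m, ((X - C β) ^ m : F[X]).Monic := fun m => (monic_X_sub_C β).pow m
  rcases Nat.even_or_odd k with ⟨m, hm⟩ | hodd
  · obtain ⟨K, hK⟩ := key m (by omega)
    obtain ⟨-, h2, h3, -, h5⟩ := isObtainedFrom_spec hK
    rw [hdeg, show 2 * m = k by omega] at h2 h5
    exact ⟨dualCode K, h2, h5, _, hmonic m, Or.inr (by rwa [h3])⟩
  · have hn : Odd n := hpar.resolve_right (Nat.not_even_iff_odd.2 hodd)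
    obtain ⟨m, hm⟩ := Nat.Odd.sub_odd hn hodd
    obtain ⟨K, hK⟩ := key m (by omega)
    obtain ⟨h1, -, -, h4, -⟩ := isObtainedFrom_spec hK
    rw [hdeg, show n - 2 * m = k by omega] at h1 h4
    exact ⟨K, h1, h4, _, hmonic m, Or.inl hK⟩

variable [Fintype F]

theorem exists_eval_ne_zero {h : F[X]} (h0 : h ≠ 0) (hd : h.natDegree < Fintype.card F) :
    ∃ x, h.eval x ≠ 0 :=
  exists_eval_ne_zero_of_natDegree_lt_card h h0 (by
    rw [Cardinal.mk_fintype]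
    exact_mod_cast hd)

/-- `X^q - X` splits over the field with simple roots, and its divisors inherit this. -/
theorem exists_listsRoots_of_dvd {g : F[X]} (hg : g.Monic) (hn : g.natDegree = n)
    (hdvd : g ∣ X ^ Fintype.card F - X) : ∃ α : Fin n → F, ListsRoots α g := by
  classical
  have h0 := FiniteField.X_pow_card_sub_X_ne_zero F (Fintype.one_lt_card (α := F))
  have hs : (X ^ Fintype.card F - X : F[X]).Splits := by
    rw [splits_iff_card_roots, FiniteField.roots_X_pow_card_sub_X,
      FiniteField.X_pow_card_sub_X_natDegree_eq F Fintype.one_lt_card]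
    rfl
  have hgs := hs.of_dvd h0 hdvd
  have hnodup : g.roots.Nodup := by
    refine Multiset.nodup_of_le (roots.le_of_dvd h0 hdvd) ?_
    rw [FiniteField.roots_X_pow_card_sub_X]
    exact Finset.univ.nodup
  obtain ⟨α, hα⟩ := exists_listsRoots_prod (n := n) ⟨g.roots, hnodup⟩
    (by rw [Finset.card_mk, splits_iff_card_roots.1 hgs, hn])
  refine ⟨α, hα.1, hα.2.trans ?_⟩
  rw [Finset.prod]
  exact (hgs.eq_prod_roots_of_monic hg).symm

end Roots

/-! ### Roots of `x^n - x` and `x^n - 1`: families 2, 4 and 5. -/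

section Multiplicative

variable {F : Type*} [Field F]

theorem natDegree_X_pow_sub_X {n : ℕ} (hn : 1 < n) : (X ^ n - X : F[X]).natDegree = n :=
  FiniteField.X_pow_card_sub_X_natDegree_eq F hn

theorem X_pow_sub_one_dvd_of_dvd {d e : ℕ} (h : d ∣ e) : (X ^ d - 1 : F[X]) ∣ X ^ e - 1 := by
  obtain ⟨k, rfl⟩ := h
  rw [pow_mul]
  exact sub_one_dvd_pow_sub_one _ _

theorem X_pow_sub_X_eq {n : ℕ} (hn : 0 < n) : (X ^ n - X : F[X]) = X * (X ^ (n - 1) - 1) := by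
  obtain ⟨m, rfl⟩ := Nat.exists_eq_succ_of_ne_zero hn.ne'
  rw [Nat.succ_sub_one, pow_succ]
  ring

theorem isCoprime_X_sub_C_pow_X_sub_C_pow {β γ : F} (h : β ≠ γ) (i j : ℕ) :
    IsCoprime ((X - C β) ^ i : F[X]) ((X - C γ) ^ j) :=
  isCoprime_X_sub_C_pow (by simpa using pow_ne_zero j (sub_ne_zero.2 h)) i

variable [Fintype F]

theorem X_pow_sub_one_dvd_X_pow_card_sub_X {d : ℕ} (h : d ∣ Fintype.card F - 1) :
    (X ^ d - 1 : F[X]) ∣ X ^ Fintype.card F - X := by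
  rw [X_pow_sub_X_eq Fintype.card_pos]
  exact (X_pow_sub_one_dvd_of_dvd h).mul_left X

theorem exists_listsRoots_X_pow_sub_X {n : ℕ} (hn : 1 < n) (h : (n - 1) ∣ Fintype.card F - 1) :
    ∃ α : Fin n → F, ListsRoots α (X ^ n - X) := by
  refine exists_listsRoots_of_dvd ?_ (natDegree_X_pow_sub_X hn) ?_
  · refine monic_X_pow_sub ?_
    rw [degree_X]
    exact_mod_cast (by omega)
  · rw [X_pow_sub_X_eq (by omega), X_pow_sub_X_eq Fintype.card_pos]
    exact mul_dvd_mul_left X (X_pow_sub_one_dvd_of_dvd h)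

theorem exists_listsRoots_X_pow_sub_one {n : ℕ} (hn : 0 < n) (h : n ∣ Fintype.card F - 1) :
    ∃ α : Fin n → F, ListsRoots α (X ^ n - 1) := by
  refine exists_listsRoots_of_dvd ?_ ?_ (X_pow_sub_one_dvd_X_pow_card_sub_X h)
  · rw [← C_1]
    exact monic_X_pow_sub_C 1 hn.ne'
  · rw [← C_1]
    exact natDegree_X_pow_sub_C

theorem exists_sq_ne_one (hF : 3 < Fintype.card F) : ∃ s : F, s ≠ 0 ∧ s ^ 2 ≠ 1 := by
  have h0 : (X ^ 3 - X : F[X]) ≠ 0 := FiniteField.X_pow_card_sub_X_ne_zero F (by norm_num)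
  obtain ⟨s, hs⟩ := exists_eval_ne_zero h0 (by rwa [natDegree_X_pow_sub_X (by norm_num)])
  refine ⟨s, ?_, ?_⟩
  · rintro rfl
    simp at hs
  · intro h
    apply hs
    simp only [eval_sub, eval_pow, eval_X]
    linear_combination s * h

theorem exists_isLCDMDS_X_pow_sub_X {p n k : ℕ} [CharP F p] (hp : p.Prime) (hp2 : p ≠ 2)
    (hn0 : 0 < n) (hn : n < Fintype.card F) (hpn : p ∣ n) (hdvd : (n - 1) ∣ Fintype.card F - 1)
    (hk : k ≤ n) :
    ∃ K : Submodule F (Fin n → F), IsLCDMDS k K ∧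
      (∃ α v : Fin n → F, ListsRoots α (X ^ n - X) ∧ (∀ i, v i ≠ 0) ∧ K = grsCode α v k) ∧
      (Odd n ∨ Even k →
        ∃ R : F[X], R.Monic ∧ IsObtainedUpToDual (X ^ n - X) (R ^ 2) 1 K) := by
  have hple := Nat.le_of_dvd hn0 hpn
  have hp3 : 3 ≤ p := by
    have := hp.two_le
    omega
  have hg := exists_listsRoots_X_pow_sub_X (by omega) hdvd
  by_cases hpar : Odd n ∨ Even k
  · obtain ⟨β, hβ⟩ := exists_eval_ne_zero (F := F)
      (FiniteField.X_pow_card_sub_X_ne_zero F (show 1 < n by omega))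
      (by rwa [natDegree_X_pow_sub_X (by omega)])
    obtain ⟨K, h1, h2, h3⟩ := exists_isLCDMDS_of_derivative_const hg (e := -1)
      (neg_ne_zero.2 one_ne_zero) (fun x _ => by
        have : (n : F) = 0 := (CharP.cast_eq_zero_iff F p n).2 hpn
        simp [derivative_X_pow, this]) hβ hk hpar
    exact ⟨K, h1, h2, fun _ => h3⟩
  -- Here `n` is even and `k` is odd, so `a = R²` with `b = 1` yields only even dimensions.
  · obtain ⟨α, hα⟩ := hg
    obtain ⟨s, hs, hs'⟩ := exists_sq_ne_one (F := F) (by omega)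
    obtain ⟨v, hv, hK⟩ := exists_isLCDMDS_grsCode hα.1 hk hs hs'
    exact ⟨_, hK, ⟨α, v, hα, hv, rfl⟩, fun h => absurd h hpar⟩

/-- Euler's criterion: `(q - 1)/2 = (s - 1)(s + 1)/2` is a multiple of `s - 1`, hence of `p - 1`. -/
theorem isSquare_of_pow_char_sub_one {p s : ℕ} [CharP F p] (hp : p.Prime) (hp2 : p ≠ 2)
    (hs : Fintype.card F = s ^ 2) (hps : (p - 1) ∣ s - 1) {x : F} (hx : x ^ (p - 1) = 1) :
    IsSquare x := by
  have hx0 : x ≠ 0 := by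
    rintro rfl
    rw [zero_pow (by have := hp.two_le; omega)] at hx
    exact zero_ne_one hx
  have hchar : ringChar F ≠ 2 := by rwa [ringChar.eq F p]
  have hodd := FiniteField.odd_card_of_char_ne_two hchar
  rw [FiniteField.isSquare_iff hchar hx0]
  have hsodd : s % 2 = 1 := by
    rcases Nat.mod_two_eq_zero_or_one s with h | h
    · rw [hs, Nat.pow_mod, h] at hodd
      simp at hodd
    · exact h
  obtain ⟨j, rfl⟩ : ∃ j, s = 2 * j + 1 := ⟨s / 2, by omega⟩
  have hhalf : Fintype.card F / 2 = (2 * j) * (j + 1) := by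
    rw [hs, show (2 * j + 1) ^ 2 = 2 * ((2 * j) * (j + 1)) + 1 by ring]
    omega
  obtain ⟨i, hi⟩ := hps
  rw [hhalf, show 2 * j = (p - 1) * i from hi, pow_mul, pow_mul, hx, one_pow, one_pow]

theorem natCast_isSquare {p s : ℕ} [CharP F p] (hp : p.Prime) (hp2 : p ≠ 2)
    (hs : Fintype.card F = s ^ 2) (hps : (p - 1) ∣ s - 1) (m : ℕ) : IsSquare (m : F) := by
  by_cases hm : (m : F) = 0
  · rw [hm]
    exact IsSquare.zero
  refine isSquare_of_pow_char_sub_one hp hp2 hs hps ?_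
  have : Fact p.Prime := ⟨hp⟩
  have h1 : (m : ZMod p) ^ (p - 1) = 1 := ZMod.pow_card_sub_one_eq_one fun h => hm (by
    rw [CharP.cast_eq_zero_iff F p]
    rwa [CharP.cast_eq_zero_iff (ZMod p) p] at h)
  have := congrArg (ZMod.castHom (dvd_refl p) F) h1
  simpa using this

/-- The derivative is `-1` at `0` and `n - 1` at the other roots, both in the prime field. The bound
`n + 1 < q` leaves two non-roots for `β` and `γ`; both exponents are even since `n` is. -/
theorem exists_isLCDMDS_of_isSquare_card {p n m : ℕ} [CharP F p] (hp : p.Prime) (hp2 : p ≠ 2)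
    {s : ℕ} (hs : Fintype.card F = s ^ 2) (hps : (p - 1) ∣ s - 1) (hn : n + 1 < Fintype.card F)
    (hodd : Odd (n - 1)) (hdvd : (n - 1) ∣ Fintype.card F - 1) (hm : 2 * m ≤ n) :
    ∃ K : Submodule F (Fin n → F), IsLCDMDS (n - 2 * m) K ∧
      ∃ β γ : F, β ≠ γ ∧
        IsObtainedFrom (X ^ n - X) ((X - C β) ^ (2 * m)) ((X - C γ) ^ (n - 2 * m)) K := by
  have hn1 : 1 < n := by
    obtain ⟨j, hj⟩ := hodd
    omega
  have h0 := FiniteField.X_pow_card_sub_X_ne_zero F hn1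
  obtain ⟨β, hβ⟩ := exists_eval_ne_zero h0
    (by rw [natDegree_X_pow_sub_X hn1]; omega)
  obtain ⟨γ, hγ⟩ := exists_eval_ne_zero (mul_ne_zero h0 (X_sub_C_ne_zero β))
    (by rwa [natDegree_mul h0 (X_sub_C_ne_zero β), natDegree_X_pow_sub_X hn1, natDegree_X_sub_C])
  rw [eval_mul] at hγ
  have hβγ : β ≠ γ := by
    rintro rfl
    simp at hγ
  have hγ := left_ne_zero_of_mul hγ
  obtain ⟨j, hj⟩ : ∃ j, n - 2 * m = 2 * j := by
    obtain ⟨i, hi⟩ := hodd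
    exact ⟨i + 1 - m, by omega⟩
  obtain ⟨K, hK⟩ := exists_isObtainedFrom (exists_listsRoots_X_pow_sub_X hn1 hdvd)
    (isCoprime_X_sub_C_pow_X_sub_C_pow hβγ (2 * m) (n - 2 * m))
    (by
      rw [natDegree_pow, natDegree_pow, natDegree_X_sub_C, natDegree_X_sub_C]
      omega) (one_ne_zero (α := F)) (fun x hx hx' => by
      have hxβ : x - β ≠ 0 := by
        rw [sub_ne_zero]
        rintro rfl
        exact hβ hx
      have hxγ : x - γ ≠ 0 := by
        rw [sub_ne_zero]
        rintro rfl
        exact hγ hx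
      have hsq : IsSquare ((derivative (X ^ n - X : F[X])).eval x) := by
        have hx2 : x = 0 ∨ x ^ (n - 1) = 1 := by
          rw [X_pow_sub_X_eq (by omega)] at hx
          simpa [sub_eq_zero] using hx
        have hcast : ∀ i : ℕ, IsSquare (i : F) := natCast_isSquare hp hp2 hs hps
        rcases hx2 with h | h
        -- The value `-1` is written as a natural number so that `natCast_isSquare` applies.
        · have h1 : (derivative (X ^ n - X : F[X])).eval x = ((p - 1 : ℕ) : F) := by
            rw [Nat.cast_sub hp.one_le, CharP.cast_eq_zero]
            simp [derivative_X_pow, h, zero_pow (show n - 1 ≠ 0 by omega)]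
          rw [h1]
          exact hcast _
        · have h1 : (derivative (X ^ n - X : F[X])).eval x = ((n - 1 : ℕ) : F) := by
            rw [Nat.cast_sub (by omega)]
            simp [derivative_X_pow, h]
          rw [h1]
          exact hcast _
      obtain ⟨t, ht⟩ := hsq
      have ht0 : t ≠ 0 := by
        rintro rfl
        exact hx' (by rw [ht, mul_zero])
      refine ⟨(x - β) ^ m * (x - γ) ^ j * t,
        mul_ne_zero (mul_ne_zero (pow_ne_zero _ hxβ) (pow_ne_zero _ hxγ)) ht0, ?_⟩
      rw [eval_mul, ht, hj]
      simp only [eval_mul, eval_pow, eval_sub, eval_X, eval_C]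
      ring)
  obtain ⟨h1, -⟩ := isObtainedFrom_spec hK
  rw [natDegree_pow, natDegree_X_sub_C, mul_one] at h1
  exact ⟨K, h1, β, γ, hβγ, hK⟩

theorem exists_isLCDMDS_X_pow_sub_one {p n m : ℕ} [CharP F p] (hp2 : p ≠ 2)
    (hdvd : n ∣ (Fintype.card F - 1) / 2) (hm1 : 1 ≤ m) (hm : 2 * m ≤ n) :
    (Even n → ∃ K : Submodule F (Fin n → F), IsLCDMDS (n - 2 * m) K ∧
      ∃ β γ : F, β ≠ γ ∧
        IsObtainedFrom (X ^ n - 1) (C (n : F) * (X - C β) ^ (2 * m))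
          ((X - C γ) ^ (n - 2 * m)) K) ∧
    (Odd n → ∃ K : Submodule F (Fin n → F), IsLCDMDS (n - 2 * m - 1) K ∧
      ∃ β γ : F, β ≠ γ ∧
        IsObtainedFrom (X ^ n - 1) (C (n : F) * X * (X - C β) ^ (2 * m))
          ((X - C γ) ^ (n - 1 - 2 * m)) K) := by
  have hchar : ringChar F ≠ 2 := by rwa [ringChar.eq F p]
  have hodd := FiniteField.odd_card_of_char_ne_two hchar
  have hq := Fintype.one_lt_card (α := F)
  have hle := Nat.le_of_dvd (by omega) hdvd
  have hdvd' : n ∣ Fintype.card F - 1 :=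
    hdvd.trans ⟨2, by omega⟩
  have hroots := exists_listsRoots_X_pow_sub_one (F := F) (n := n) (by omega) hdvd'
  have hmon : (X ^ n - 1 : F[X]).Monic := by
    rw [← C_1]
    exact monic_X_pow_sub_C 1 (by omega)
  -- The other point `β` is `0`, which is never a root, so `γ` must avoid both the roots and `0`.
  obtain ⟨γ, hγ⟩ := exists_eval_ne_zero (mul_ne_zero hmon.ne_zero (X_ne_zero (R := F))) (by
    rw [natDegree_mul hmon.ne_zero X_ne_zero, natDegree_X, ← C_1, natDegree_X_pow_sub_C]
    omega)
  rw [eval_mul, eval_X] at hγ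
  have hγ0 : (0 : F) ≠ γ := (right_ne_zero_of_mul hγ).symm
  have hγ := left_ne_zero_of_mul hγ
  have hnF : (n : F) ≠ 0 := by
    intro h
    obtain ⟨α, hα⟩ := hroots
    apply hα.eval_derivative_ne_zero ⟨0, by omega⟩
    simp [derivative_X_pow, h]
  have key : ∀ x : F, (X ^ n - 1 : F[X]).eval x = 0 →
      x ≠ 0 ∧ x - γ ≠ 0 ∧ x ^ n = 1 ∧ ∃ t, t ≠ 0 ∧ x = t * t := by
    intro x hx
    have hxn : x ^ n = 1 := by simpa [sub_eq_zero] using hx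
    have hx0 : x ≠ 0 := by
      rintro rfl
      rw [zero_pow (by omega)] at hxn
      exact zero_ne_one hxn
    have hxγ : x - γ ≠ 0 := by
      rw [sub_ne_zero]
      rintro rfl
      exact hγ hx
    have hsq : IsSquare x := by
      rw [FiniteField.isSquare_iff hchar hx0]
      obtain ⟨j, hj⟩ := hdvd
      rw [show Fintype.card F / 2 = n * j by omega, pow_mul, hxn, one_pow]
    obtain ⟨t, ht⟩ := hsq
    exact ⟨hx0, hxγ, hxn, t, by rintro rfl; exact hx0 (by rw [ht, mul_zero]), ht⟩
  have hC : (C (n : F)) ≠ 0 := C_ne_zero.2 hnF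
  have hcop : ∀ i j, IsCoprime (C (n : F) * (X - C 0) ^ i : F[X]) ((X - C γ) ^ j) := fun i j =>
    (isCoprime_mul_unit_left_left (isUnit_C.2 (isUnit_iff_ne_zero.2 hnF)) _ _).2
      (isCoprime_X_sub_C_pow_X_sub_C_pow hγ0 i j)
  have hdeg : ∀ i, (C (n : F) * (X - C 0) ^ i : F[X]).natDegree = i := fun i => by
    rw [natDegree_C_mul hnF, natDegree_pow, natDegree_X_sub_C, mul_one]
  refine ⟨fun heven => ?_, fun hoddn => ?_⟩
  · obtain ⟨i, hi⟩ := heven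
    obtain ⟨K, hK⟩ := exists_isObtainedFrom hroots (hcop (2 * m) (n - 2 * m)) (by
      rw [hdeg, natDegree_pow, natDegree_X_sub_C]
      omega) (one_ne_zero (α := F)) (fun x hx _ => by
      obtain ⟨hx0, hxγ, hxn, t, ht0, ht⟩ := key x hx
      refine ⟨n * x ^ m * (x - γ) ^ (i - m) * t⁻¹, mul_ne_zero (mul_ne_zero (mul_ne_zero hnF
        (pow_ne_zero _ hx0)) (pow_ne_zero _ hxγ)) (inv_ne_zero ht0), ?_⟩
      -- At a root, `g' = n x^(n-1) = n / x`, and `x` is a square because `n ∣ (q - 1)/2`. For odd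
      -- `n` the extra factor `x` of `a` cancels this `1 / x` instead.
      have hx1 : x ^ (n - 1) = (t⁻¹) ^ 2 := by
        rw [inv_pow, pow_two t, ← ht, ← one_div, eq_div_iff hx0, ← pow_succ,
          show n - 1 + 1 = n by omega, hxn]
      rw [show n - 2 * m = 2 * (i - m) by omega]
      simp only [eval_mul, eval_pow, eval_sub, eval_X, eval_C, derivative_sub, derivative_X_pow,
        derivative_one, eval_zero, hx1]
      ring)
    obtain ⟨h1, -⟩ := isObtainedFrom_spec hK
    rw [hdeg] at h1
    exact ⟨K, h1, 0, γ, hγ0, hK⟩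
  · obtain ⟨i, hi⟩ := hoddn
    have heq : C (n : F) * X * (X - C 0) ^ (2 * m) = C (n : F) * (X - C 0) ^ (2 * m + 1) := by
      rw [C_0, sub_zero, pow_succ]
      ring
    obtain ⟨K, hK⟩ := exists_isObtainedFrom hroots (hcop (2 * m + 1) (n - 1 - 2 * m)) (by
      rw [hdeg, natDegree_pow, natDegree_X_sub_C]
      omega) (one_ne_zero (α := F)) (fun x hx _ => by
      obtain ⟨hx0, hxγ, hxn, -⟩ := key x hx
      refine ⟨n * x ^ m * (x - γ) ^ (i - m), mul_ne_zero (mul_ne_zero hnF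
        (pow_ne_zero _ hx0)) (pow_ne_zero _ hxγ), ?_⟩
      have hx1 : x * x ^ (n - 1) = 1 := by
        rw [← pow_succ', show n - 1 + 1 = n by omega, hxn]
      rw [show n - 1 - 2 * m = 2 * (i - m) by omega]
      simp only [eval_mul, eval_pow, eval_sub, eval_X, eval_C, derivative_sub, derivative_X_pow,
        derivative_one, eval_zero]
      linear_combination (-(n : F) ^ 2 * x ^ (2 * m) * (x - γ) ^ (2 * (i - m))) * hx1)
    obtain ⟨h1, -⟩ := isObtainedFrom_spec hK
    rw [hdeg, ← Nat.sub_sub] at h1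
    exact ⟨K, h1, 0, γ, hγ0, by rwa [heq]⟩

end Multiplicative

/-! ### Irreducible polynomials coprime to a given polynomial. -/

section Translates

variable {F : Type*} [Field F]

theorem irreducible_comp_X_add_C {P : F[X]} (hP : Irreducible P) (u : F) :
    Irreducible (P.comp (X + C u)) := by
  have := (MulEquiv.irreducible_iff (algEquivAevalXAddC u)).2 hP
  rwa [algEquivAevalXAddC_apply] at this

variable [Fintype F]

theorem X_pow_card_sub_X_comp_X_add_C (y : F) :
    (X ^ Fintype.card F - X : F[X]).comp (X + C y) = X ^ Fintype.card F - X := by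
  obtain ⟨p, _, r, hp, hF⟩ := FiniteField.card' F
  have : Fact p.Prime := ⟨hp⟩
  have h : (X + C y) ^ Fintype.card F = X ^ Fintype.card F + C y := by
    conv_rhs => rw [← FiniteField.pow_card y]
    rw [hF, add_pow_char_pow, C_pow]
  rw [sub_comp, X_pow_comp, X_comp, h]
  ring

/-- If every translate of `P` divided `b`, then `b` would have the `q` distinct roots `θ + u` with
`u` in the field, where `θ` is a root of `P` in an extension. This exceeds its degree. -/
theorem exists_irreducible_isCoprime {P b : F[X]} (hP : P.Monic) (hirr : Irreducible P)
    (hb : b ≠ 0) (hdeg : b.natDegree < Fintype.card F) :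
    ∃ R : F[X], R.Monic ∧ Irreducible R ∧ R.natDegree = P.natDegree ∧ IsCoprime R b := by
  by_contra hcon
  push Not at hcon
  have hdvd : ∀ u : F, P.comp (X + C (-u)) ∣ b := by
    intro u
    have h1 := irreducible_comp_X_add_C hirr (-u)
    have h2 := hcon (P.comp (X + C (-u))) (hP.comp_X_add_C _) h1
      (by rw [natDegree_comp, natDegree_X_add_C, mul_one])
    rwa [h1.coprime_iff_not_dvd, not_not] at h2
  have : Fact (Irreducible P) := ⟨hirr⟩
  set θ := AdjoinRoot.root P
  have hinj : Function.Injective fun u : F => θ + algebraMap F (AdjoinRoot P) u := fun u v h =>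
    (algebraMap F (AdjoinRoot P)).injective (add_left_cancel h)
  refine map_ne_zero (f := algebraMap F (AdjoinRoot P)) hb
    (eq_zero_of_natDegree_lt_card_of_eval_eq_zero (b.map (algebraMap F (AdjoinRoot P))) hinj
      (fun u => ?_) (by rwa [natDegree_map]))
  obtain ⟨h, hh⟩ := hdvd u
  rw [eval_map_algebraMap, hh, map_mul, aeval_comp]
  have : aeval (θ + algebraMap F (AdjoinRoot P) u) (X + C (-u) : F[X]) = θ := by
    simp
  rw [this, AdjoinRoot.aeval_eq, AdjoinRoot.mk_self, zero_mul]

theorem exists_monic_irreducible_natDegree_eq {m : ℕ} (hm : m ≠ 0) :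
    ∃ P : F[X], P.Monic ∧ Irreducible P ∧ P.natDegree = m := by
  obtain ⟨p, _, r, hp, hF⟩ := FiniteField.card' F
  have : Fact p.Prime := ⟨hp⟩
  have : NeZero m := ⟨hm⟩
  obtain ⟨θ, hθ⟩ := Field.exists_primitive_element F (FiniteField.Extension F p m)
  have hint : IsIntegral F θ := .of_finite F θ
  refine ⟨minpoly F θ, minpoly.monic hint, minpoly.irreducible hint, ?_⟩
  rw [(Field.primitive_element_iff_minpoly_natDegree_eq F θ).1 hθ, FiniteField.finrank_extension]

end Translates

/-! ### Subspace polynomials and unions of cosets: families 1 and 7. -/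

section Subspace

variable {F : Type*} [Field F] [Fintype F] (V : AddSubgroup F)

theorem monic_subspacePoly : (subspacePoly V).Monic := monic_prod_X_sub_C _ _

open Classical in
theorem card_filter_mem_addSubgroup :
    (Finset.univ.filter fun x : F => x ∈ V).card = Nat.card V := by
  rw [Nat.card_eq_fintype_card, Fintype.card_subtype]

theorem natDegree_subspacePoly : (subspacePoly V).natDegree = Nat.card V := by
  rw [subspacePoly, natDegree_finsetProd_X_sub_C_eq_card, card_filter_mem_addSubgroup]

theorem eval_subspacePoly_eq_zero {x : F} : (subspacePoly V).eval x = 0 ↔ x ∈ V := by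
  simp [subspacePoly, eval_prod, Finset.prod_eq_zero_iff, sub_eq_zero]

theorem eval_subspacePoly_add_of_mem {v : F} (hv : v ∈ V) (y : F) :
    (subspacePoly V).eval (v + y) = (subspacePoly V).eval y := by
  simp only [subspacePoly, eval_prod, eval_sub, eval_X, eval_C]
  refine Finset.prod_nbij' (fun x => x - v) (fun x => x + v) ?_ ?_ ?_ ?_ ?_
  · intro x hx
    simpa using V.sub_mem (by simpa using hx) hv
  · intro x hx
    simpa using V.add_mem (by simpa using hx) hv
  · intro x _
    ring
  · intro x _
    ring
  · intro x _
    ring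

/-- The difference of the two sides has degree below `|V|`, since the leading terms cancel, and it
vanishes on `V`. Additivity and the constancy of the derivative follow from this identity. -/
theorem subspacePoly_comp_X_add_C (y : F) :
    (subspacePoly V).comp (X + C y) = subspacePoly V + C ((subspacePoly V).eval y) := by
  classical
  have hmon := (monic_subspacePoly V).comp_X_add_C y
  have hdeg : ((subspacePoly V).comp (X + C y)).natDegree = Nat.card V := by
    rw [natDegree_comp, natDegree_X_add_C, mul_one, natDegree_subspacePoly]
  have hcard : (0 : ℕ) < Nat.card V := Nat.card_pos
  have hlt : ((subspacePoly V).comp (X + C y) - subspacePoly V).degree < (Nat.card V : ℕ) := by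
    have h1 := degree_sub_lt_left (p := (subspacePoly V).comp (X + C y)) (q := subspacePoly V)
      (by rw [degree_eq_natDegree hmon.ne_zero, degree_eq_natDegree (monic_subspacePoly V).ne_zero,
        hdeg, natDegree_subspacePoly]) hmon.ne_zero
      (by rw [hmon.leadingCoeff, (monic_subspacePoly V).leadingCoeff])
    rwa [degree_eq_natDegree hmon.ne_zero, hdeg] at h1
  rw [← sub_eq_zero, ← sub_sub]
  refine eq_zero_of_degree_lt_of_eval_finset_eq_zero (Finset.univ.filter fun x : F => x ∈ V) ?_ ?_
  · rw [card_filter_mem_addSubgroup]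
    refine (degree_sub_le _ _).trans_lt (max_lt hlt (degree_C_le.trans_lt ?_))
    exact_mod_cast hcard
  · intro v hv
    have hv : v ∈ V := by simpa using hv
    simp [eval_comp, eval_subspacePoly_add_of_mem V hv, (eval_subspacePoly_eq_zero V).2 hv]

theorem eval_subspacePoly_add (x y : F) :
    (subspacePoly V).eval (x + y) = (subspacePoly V).eval x + (subspacePoly V).eval y := by
  have := congrArg (eval x) (subspacePoly_comp_X_add_C V y)
  simpa [eval_comp] using this

theorem eval_subspacePoly_neg (y : F) :
    (subspacePoly V).eval (-y) = -(subspacePoly V).eval y := by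
  rw [eq_neg_iff_add_eq_zero, ← eval_subspacePoly_add, neg_add_cancel,
    eval_subspacePoly_eq_zero]
  exact V.zero_mem

theorem eval_subspacePoly_eq_iff {x y : F} :
    (subspacePoly V).eval x = (subspacePoly V).eval y ↔ x - y ∈ V := by
  rw [← eval_subspacePoly_eq_zero, sub_eq_add_neg x y, eval_subspacePoly_add,
    eval_subspacePoly_neg, ← sub_eq_add_neg, sub_eq_zero]

theorem eval_derivative_subspacePoly (y : F) :
    (derivative (subspacePoly V)).eval y = (derivative (subspacePoly V)).eval 0 := by
  have := congrArg (fun P => (derivative P).eval 0) (subspacePoly_comp_X_add_C V y)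
  simpa [derivative_comp, eval_comp] using this

theorem exists_listsRoots_subspacePoly {n : ℕ} (hn : Nat.card V = n) :
    ∃ α : Fin n → F, ListsRoots α (subspacePoly V) := by
  classical
  exact exists_listsRoots_prod _ (by rw [card_filter_mem_addSubgroup, hn])

theorem eval_zero_derivative_subspacePoly_ne_zero :
    (derivative (subspacePoly V)).eval 0 ≠ 0 := by
  obtain ⟨α, hα⟩ := exists_listsRoots_subspacePoly V rfl
  rw [← eval_derivative_subspacePoly V (α ⟨0, Nat.card_pos⟩)]
  exact hα.eval_derivative_ne_zero _

/-- The left side is the translate by `-y` of a divisor of `X^q - X`, and `X^q - X` is invariant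
under translation. -/
theorem subspacePoly_sub_C_dvd (y : F) :
    subspacePoly V - C ((subspacePoly V).eval y) ∣ X ^ Fintype.card F - X := by
  classical
  have h1 : subspacePoly V ∣ X ^ Fintype.card F - X := by
    refine Finset.prod_dvd_of_coprime
      ((pairwise_coprime_X_sub_C Function.injective_id).set_pairwise _) fun x _ => ?_
    rw [dvd_iff_isRoot]
    simp [FiniteField.pow_card]
  have h2 := map_dvd (compRingHom (X + C (-y))) h1
  rwa [coe_compRingHom_apply, coe_compRingHom_apply, X_pow_card_sub_X_comp_X_add_C,
    subspacePoly_comp_X_add_C, eval_subspacePoly_neg, C_neg, ← sub_eq_add_neg] at h2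

theorem exists_addSubgroup_card_eq {p t : ℕ} (hp : p.Prime) (h : p ^ t ∣ Fintype.card F) :
    ∃ V : AddSubgroup F, Nat.card V = p ^ t := by
  have : Fact p.Prime := ⟨hp⟩
  obtain ⟨K, hK⟩ := Sylow.exists_subgroup_card_pow_prime (G := Multiplicative F) p (n := t)
    (by rwa [Nat.card_eq_fintype_card, Fintype.card_multiplicative])
  exact ⟨Subgroup.toAddSubgroup' K, hK⟩

theorem exists_finset_distinct_cosets {d : ℕ} (hd : d ≤ Nat.card (F ⧸ V)) :
    ∃ B : Finset F, B.card = d ∧ ∀ x ∈ B, ∀ y ∈ B, x - y ∈ V → x = y := by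
  classical
  have : Fintype (F ⧸ V) := Fintype.ofFinite _
  rw [Nat.card_eq_fintype_card, ← Finset.card_univ] at hd
  obtain ⟨T, -, hT⟩ := Finset.exists_subset_card_eq hd
  have hinj : Function.Injective (Quotient.out : F ⧸ V → F) := Quotient.out_injective
  refine ⟨T.image Quotient.out, by rw [Finset.card_image_of_injective _ hinj, hT], ?_⟩
  intro x hx y hy hxy
  obtain ⟨a, -, rfl⟩ := Finset.mem_image.1 hx
  obtain ⟨b, -, rfl⟩ := Finset.mem_image.1 hy
  congr 1
  rw [← QuotientAddGroup.out_eq' a, ← QuotientAddGroup.out_eq' b, eq_comm, QuotientAddGroup.eq]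
  rwa [neg_add_eq_sub]

theorem exists_isLCDMDS_subspacePoly {p t k : ℕ} (hp : p.Prime) (hp2 : p ≠ 2)
    (hdvd : p ^ t ∣ Fintype.card F) (hlt : p ^ t < Fintype.card F) (hk : k ≤ p ^ t) :
    ∃ K : Submodule F (Fin (p ^ t) → F), IsLCDMDS k K ∧
      ∃ V : AddSubgroup F, Nat.card V = p ^ t ∧
        ∃ R : F[X], R.Monic ∧ IsObtainedUpToDual (subspacePoly V) (R ^ 2) 1 K := by
  obtain ⟨V, hV⟩ := exists_addSubgroup_card_eq hp hdvd
  obtain ⟨β, hβ⟩ := exists_eval_ne_zero (monic_subspacePoly V).ne_zero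
    (by rwa [natDegree_subspacePoly, hV])
  obtain ⟨K, h1, -, h2⟩ := exists_isLCDMDS_of_derivative_const
    (exists_listsRoots_subspacePoly V hV) (eval_zero_derivative_subspacePoly_ne_zero V)
    (fun x _ => eval_derivative_subspacePoly V x) hβ hk (Or.inl (hp.odd_of_ne_two hp2).pow)
  exact ⟨K, h1, V, hV, h2⟩

theorem exists_listsRoots_comp_subspacePoly {n d : ℕ} (B : Finset F) (hB : B.card = d)
    (hBV : ∀ x ∈ B, ∀ y ∈ B, x - y ∈ V → x = y) (hn : d * Nat.card V = n) :
    ∃ α : Fin n → F, ListsRoots α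
      ((∏ x ∈ B, (X - C ((subspacePoly V).eval x))).comp (subspacePoly V)) := by
  classical
  refine exists_listsRoots_of_dvd ((monic_prod_X_sub_C _ _).comp (monic_subspacePoly V) ?_) ?_ ?_
  · rw [natDegree_subspacePoly]
    exact Nat.card_pos.ne'
  · rw [natDegree_comp, natDegree_finsetProd_X_sub_C_eq_card, natDegree_subspacePoly, hB, hn]
  · rw [prod_comp]
    refine Finset.prod_dvd_of_coprime (fun x hx y hy hxy => ?_) fun x _ => ?_
    · have hne : (subspacePoly V).eval x ≠ (subspacePoly V).eval y := fun h =>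
        hxy (hBV x hx y hy ((eval_subspacePoly_eq_iff V).1 h))
      have := (isCoprime_X_sub_C_of_isUnit_sub (sub_ne_zero.2 hne).isUnit).map
        (compRingHom (subspacePoly V))
      exact this
    · rw [sub_comp, X_comp, C_comp]
      exact subspacePoly_sub_C_dvd V x

/-- At each root, `g' = L'(0) f'(L)`, so with `b = f'(L)` and `c = L'(0)⁻¹` the product is `(R
f'(L))²`. The cosets may fill the whole field, so `R` is taken irreducible of degree `m ≥ 2`, which
excludes rational roots. -/
theorem exists_isLCDMDS_comp_subspacePoly {p t d m : ℕ} (hp : p.Prime)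
    (hdvd : p ^ t ∣ Fintype.card F) (hd : 1 ≤ d) (hle : d * p ^ t ≤ Fintype.card F)
    (hm : 2 ≤ m) (hmt : 2 * m ≤ p ^ t) :
    ∃ K : Submodule F (Fin (d * p ^ t) → F), IsLCDMDS (d * p ^ t - 2 * m) K ∧
      ∃ (V : AddSubgroup F) (B : Finset F) (R : F[X]), Nat.card V = p ^ t ∧ B.card = d ∧
        (∀ x ∈ B, ∀ y ∈ B, x - y ∈ V → x = y) ∧ R.Monic ∧ R.natDegree = m ∧
        IsObtainedFrom
          ((∏ x ∈ B, (X - C ((subspacePoly V).eval x))).comp (subspacePoly V)) (R ^ 2)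
          ((derivative (∏ x ∈ B, (X - C ((subspacePoly V).eval x)))).comp (subspacePoly V)) K := by
  obtain ⟨V, hV⟩ := exists_addSubgroup_card_eq hp hdvd
  have hpt : 0 < p ^ t := pow_pos hp.pos t
  have hquot : d ≤ Nat.card (F ⧸ V) := by
    have h1 := AddSubgroup.card_eq_card_quotient_mul_card_addSubgroup V
    rw [hV, Nat.card_eq_fintype_card] at h1
    rw [h1] at hle
    exact Nat.le_of_mul_le_mul_right hle hpt
  obtain ⟨B, hB, hBV⟩ := exists_finset_distinct_cosets V hquot
  have hroots := exists_listsRoots_comp_subspacePoly V B hB hBV (n := d * p ^ t) (by rw [hV])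
  set L := subspacePoly V with hL
  set f : F[X] := ∏ x ∈ B, (X - C (L.eval x)) with hf
  have hder : ∀ x, (derivative (f.comp L)).eval x =
      (derivative L).eval 0 * ((derivative f).comp L).eval x := by
    intro x
    rw [derivative_comp, eval_mul, eval_derivative_subspacePoly]
  have hL0 : (derivative L).eval 0 ≠ 0 := eval_zero_derivative_subspacePoly_ne_zero V
  have hb0 : (derivative f).comp L ≠ 0 := by
    intro h
    obtain ⟨α, hα⟩ := hroots
    apply hα.eval_derivative_ne_zero ⟨0, Nat.mul_pos hd hpt⟩
    rw [hder, h, eval_zero, mul_zero]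
  -- This leaves room `p ^ t ≥ 2 * m` for `R ^ 2`, and keeps the degree below `q` for the choice of
  -- `R`.
  have hbdeg : ((derivative f).comp L).natDegree ≤ (d - 1) * p ^ t := by
    rw [natDegree_comp, hL, natDegree_subspacePoly, hV]
    refine Nat.mul_le_mul_right _ ((natDegree_derivative_le f).trans ?_)
    rw [hf, natDegree_finsetProd_X_sub_C_eq_card, hB]
  have hsplit : (d - 1) * p ^ t + p ^ t = d * p ^ t := by
    obtain ⟨e, rfl⟩ := Nat.exists_eq_add_of_le' hd
    rw [Nat.add_sub_cancel]
    ring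
  obtain ⟨P, hP, hPirr, hPdeg⟩ := exists_monic_irreducible_natDegree_eq (F := F)
    (show m ≠ 0 by omega)
  obtain ⟨R, hR, hRirr, hRdeg, hRb⟩ := exists_irreducible_isCoprime hP hPirr hb0 (by omega)
  rw [hPdeg] at hRdeg
  have hR0 : ∀ x, R.eval x ≠ 0 := by
    intro x hx
    have := degree_eq_one_of_irreducible_of_root hRirr hx
    rw [degree_eq_natDegree hR.ne_zero, hRdeg] at this
    have : m = 1 := by exact_mod_cast this
    omega
  have hadeg : (R ^ 2).natDegree = 2 * m := by rw [natDegree_pow, hRdeg]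
  obtain ⟨K, hK⟩ := exists_isObtainedFrom hroots (hRb.pow_left (m := 2)) (by omega)
    (inv_ne_zero hL0) (fun x _ hx => by
      rw [hder] at hx
      refine ⟨R.eval x * ((derivative f).comp L).eval x,
        mul_ne_zero (hR0 x) (right_ne_zero_of_mul hx), ?_⟩
      rw [eval_mul, hder, eval_mul, eval_pow]
      field_simp)
  have h1 := (isObtainedFrom_spec hK).1
  rw [hadeg] at h1
  exact ⟨K, h1, V, B, R, hV, hB, hBV, hR, hRdeg, hK⟩

end Subspace

/-! ### Unions of `p` cosets of the `ℓ`-th roots of unity: family 3. -/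

section Cosets

variable {F : Type*} [Field F] {p : ℕ}

/-- In characteristic `p` the sum is `δ (δ^p - 1)/(δ - 1) = δ (δ - 1)^(p-1)`. -/
theorem sum_Icc_pow_ne_zero [CharP F p] (hp : p.Prime) {δ : F} (h0 : δ ≠ 0) (h1 : δ ≠ 1) :
    ∑ i ∈ Finset.Icc 1 p, δ ^ i ≠ 0 := by
  have : Fact p.Prime := ⟨hp⟩
  have hsum : ∑ i ∈ Finset.Icc 1 p, δ ^ i = δ * ∑ i ∈ Finset.range p, δ ^ i := by
    rw [Finset.mul_sum]
    refine Finset.sum_nbij' (fun i => i - 1) (fun i => i + 1) ?_ ?_ ?_ ?_ ?_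
    · intro i hi
      rw [Finset.mem_Icc] at hi
      rw [Finset.mem_range]
      omega
    · intro i hi
      rw [Finset.mem_range] at hi
      rw [Finset.mem_Icc]
      omega
    · intro i hi
      rw [Finset.mem_Icc] at hi
      omega
    · intro i _
      omega
    · intro i hi
      rw [Finset.mem_Icc] at hi
      rw [← pow_succ', Nat.sub_add_cancel hi.1]
  have hgeom := geom_sum_mul δ p
  rw [show δ ^ p - 1 = (δ - 1) ^ p by rw [sub_pow_char, one_pow]] at hgeom
  rw [hsum]
  refine mul_ne_zero h0 fun h => ?_
  rw [h, zero_mul] at hgeom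
  exact pow_ne_zero p (sub_ne_zero.2 h1) hgeom.symm

variable {ℓ : ℕ} {γ : F}

theorem cosetPoly_eq : cosetPoly p ℓ γ = ∏ i ∈ Finset.Icc 1 p, (X - C ((γ ^ ℓ) ^ i)) :=
  Finset.prod_congr rfl fun i _ => by rw [← pow_mul, mul_comm ℓ i]

theorem monic_cosetPoly : (cosetPoly p ℓ γ).Monic := monic_prod_X_sub_C _ _

theorem natDegree_cosetPoly : (cosetPoly p ℓ γ).natDegree = p := by
  rw [cosetPoly, natDegree_finsetProd_X_sub_C_eq_card, Nat.card_Icc, Nat.add_sub_cancel]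

theorem eval_zero_cosetPoly_ne_zero (hγ : γ ≠ 0) : (cosetPoly p ℓ γ).eval 0 ≠ 0 := by
  rw [cosetPoly, eval_prod, Finset.prod_ne_zero_iff]
  intro i _
  simp [hγ]

/-- The logarithmic derivative at `0` is minus the sum of the inverse roots, a sum of the same
geometric shape. This makes `f'(x^ℓ)` coprime to `b = x` when `ℓ` is even. -/
theorem eval_zero_derivative_cosetPoly_ne_zero [CharP F p] (hp : p.Prime) (hγ : γ ≠ 0)
    (h1 : γ ^ ℓ ≠ 1) : (derivative (cosetPoly p ℓ γ)).eval 0 ≠ 0 := by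
  have hδ : γ ^ ℓ ≠ 0 := pow_ne_zero ℓ hγ
  have h : (derivative (cosetPoly p ℓ γ)).eval 0 =
      -(cosetPoly p ℓ γ).eval 0 * ∑ i ∈ Finset.Icc 1 p, ((γ ^ ℓ)⁻¹) ^ i := by
    rw [cosetPoly_eq, derivative_prod_finset, eval_finsetSum, Finset.mul_sum]
    refine Finset.sum_congr rfl fun i hi => ?_
    rw [← Finset.prod_erase_mul _ _ hi, eval_mul, eval_mul]
    simp only [derivative_sub, derivative_X, derivative_C, eval_sub, eval_X, eval_C, eval_one,
      eval_zero]
    rw [inv_pow, zero_sub, sub_zero, mul_one, mul_neg, neg_neg,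
      mul_inv_cancel_right₀ (pow_ne_zero i hδ)]
  rw [h]
  exact mul_ne_zero (neg_ne_zero.2 (eval_zero_cosetPoly_ne_zero hγ))
    (sum_Icc_pow_ne_zero hp (inv_ne_zero hδ) (by rwa [ne_eq, inv_eq_one]))

/-- The term of degree `p - 1` dies in characteristic `p`; the next coefficient is the sum of the
roots, up to a nonzero factor. -/
theorem natDegree_derivative_cosetPoly [CharP F p] (hp : p.Prime) (hγ : γ ≠ 0)
    (h1 : γ ^ ℓ ≠ 1) : (derivative (cosetPoly p ℓ γ)).natDegree = p - 2 := by
  have h2 := hp.two_le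
  refine natDegree_eq_of_le_of_coeff_ne_zero ?_ ?_
  · rw [natDegree_le_iff_coeff_eq_zero]
    intro N hN
    rw [coeff_derivative]
    rcases (show N = p - 1 ∨ p < N + 1 by omega) with rfl | h
    · rw [← Nat.cast_add_one, Nat.sub_add_cancel hp.one_le, CharP.cast_eq_zero, mul_zero]
    · rw [coeff_eq_zero_of_natDegree_lt (by rwa [natDegree_cosetPoly]), zero_mul]
  · have h3 := prod_X_sub_C_coeff_card_pred (Finset.Icc 1 p) (fun i => (γ ^ ℓ) ^ i)
      (by rw [Nat.card_Icc]; omega)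
    rw [Nat.card_Icc, Nat.add_sub_cancel, ← cosetPoly_eq] at h3
    rw [coeff_derivative, ← Nat.cast_add_one, show p - 2 + 1 = p - 1 by omega, h3,
      Nat.cast_sub hp.one_le, CharP.cast_eq_zero, Nat.cast_one, zero_sub, mul_neg, mul_one,
      neg_neg]
    exact sum_Icc_pow_ne_zero hp (pow_ne_zero ℓ hγ) h1

variable [Fintype F]

theorem exists_orderOf_eq_card_sub_one (F : Type*) [Field F] [Fintype F] :
    ∃ γ : F, γ ≠ 0 ∧ orderOf γ = Fintype.card F - 1 := by
  classical
  obtain ⟨u, hu⟩ := IsCyclic.exists_generator (α := Fˣ)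
  refine ⟨u, u.ne_zero, ?_⟩
  rw [orderOf_units, orderOf_eq_card_of_forall_mem_zpowers hu, Nat.card_eq_fintype_card,
    Fintype.card_units]

theorem exists_listsRoots_cosetPoly_comp (hℓ : ℓ ∣ Fintype.card F - 1)
    (hlt : p * ℓ < Fintype.card F) (hγ0 : γ ≠ 0) (hγ : orderOf γ = Fintype.card F - 1) :
    ∃ α : Fin (p * ℓ) → F, ListsRoots α ((cosetPoly p ℓ γ).comp (X ^ ℓ)) := by
  have hq := Fintype.one_lt_card (α := F)
  obtain ⟨M, hM⟩ := hℓ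
  have hℓ0 : ℓ ≠ 0 := by
    rintro rfl
    omega
  have hord : orderOf (γ ^ ℓ) = M := by
    rw [orderOf_pow_of_dvd hℓ0 (by rw [hγ, hM]; exact dvd_mul_right _ _), hγ, hM,
      Nat.mul_div_cancel_left _ (Nat.pos_of_ne_zero hℓ0)]
  have hpM : p ≤ M := by
    refine Nat.le_of_mul_le_mul_left ?_ (Nat.pos_of_ne_zero hℓ0)
    rw [← hM, mul_comm]
    omega
  have hinj : ∀ i ∈ Finset.Icc 1 p, ∀ j ∈ Finset.Icc 1 p,
      (γ ^ ℓ) ^ i = (γ ^ ℓ) ^ j → i = j := by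
    intro i hi j hj hij
    rw [Finset.mem_Icc] at hi hj
    have h1 : (γ ^ ℓ) ^ (i - 1) = (γ ^ ℓ) ^ (j - 1) := by
      refine mul_right_cancel₀ (pow_ne_zero ℓ hγ0) ?_
      rwa [← pow_succ, ← pow_succ, Nat.sub_add_cancel hi.1, Nat.sub_add_cancel hj.1]
    have h2 := pow_injOn_Iio_orderOf (x := γ ^ ℓ)
      (show i - 1 ∈ Set.Iio _ by rw [hord, Set.mem_Iio]; omega)
      (show j - 1 ∈ Set.Iio _ by rw [hord, Set.mem_Iio]; omega) h1
    omega
  have hdvd : cosetPoly p ℓ γ ∣ X ^ M - 1 := by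
    rw [cosetPoly_eq]
    refine Finset.prod_dvd_of_coprime (fun i hi j hj hij => ?_) fun i _ => ?_
    · exact isCoprime_X_sub_C_of_isUnit_sub
        (sub_ne_zero.2 fun h => hij (hinj i hi j hj h)).isUnit
    · rw [dvd_iff_isRoot]
      simp only [IsRoot.def, eval_sub, eval_pow, eval_X, eval_one]
      rw [← pow_mul, mul_comm, pow_mul, ← hord, pow_orderOf_eq_one, one_pow, sub_self]
  refine exists_listsRoots_of_dvd (monic_cosetPoly.comp (monic_X_pow ℓ) ?_) ?_ ?_
  · rwa [natDegree_X_pow]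
  · rw [natDegree_comp, natDegree_cosetPoly, natDegree_X_pow]
  · have h := map_dvd (compRingHom (X ^ ℓ)) hdvd
    rw [coe_compRingHom_apply, coe_compRingHom_apply, sub_comp, X_pow_comp, one_comp, ← pow_mul,
      ← hM] at h
    exact h.trans (X_pow_sub_one_dvd_X_pow_card_sub_X dvd_rfl)

theorem exists_isLCDMDS_cosetPoly [CharP F p] (hp : p.Prime) (hp2 : p ≠ 2) {m : ℕ}
    (hℓ : ℓ ∣ Fintype.card F - 1) (hlt : p * ℓ < Fintype.card F)
    (heven : Even ℓ → m ≤ ℓ - 1) (hodd : Odd ℓ → m ≤ ℓ) :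
    ∃ K : Submodule F (Fin (p * ℓ) → F), IsLCDMDS (2 * ℓ - 2 * m) K ∧
      ∃ (γ : F) (R : F[X]), orderOf γ = Fintype.card F - 1 ∧ R.Monic ∧ R.natDegree = m ∧
        IsObtainedFrom ((cosetPoly p ℓ γ).comp (X ^ ℓ))
          (R ^ 2 * (derivative (cosetPoly p ℓ γ)).comp (X ^ ℓ)) (if Even ℓ then X else 1) K := by
  have hq := Fintype.one_lt_card (α := F)
  have hqF : ((Fintype.card F : ℕ) : F) = 0 := FiniteField.cast_card_eq_zero F
  have hpdvd : p ∣ Fintype.card F := (CharP.cast_eq_zero_iff F p _).1 hqF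
  -- Since `p` divides `q` but not `p * ℓ + 1`, equality is impossible. This leaves a nonzero `β`
  -- outside the roots of `g`.
  have hlt' : p * ℓ + 1 < Fintype.card F := by
    refine lt_of_le_of_ne hlt fun h => ?_
    have := (Nat.dvd_add_right (dvd_mul_right p ℓ)).1 (h ▸ hpdvd : p ∣ p * ℓ + 1)
    exact hp.one_lt.ne' (Nat.dvd_one.1 this)
  have hℓ0 : ℓ ≠ 0 := by
    rintro rfl
    rw [zero_dvd_iff] at hℓ
    omega
  have hp3 : 3 ≤ p := by
    have := hp.two_le
    omega
  obtain ⟨γ, hγ0, hγ⟩ := exists_orderOf_eq_card_sub_one F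
  have hγ1 : γ ^ ℓ ≠ 1 := by
    intro h
    have h1 := Nat.le_of_dvd (Nat.pos_of_ne_zero hℓ0) (orderOf_dvd_of_pow_eq_one h)
    rw [hγ] at h1
    have h2 : 3 * ℓ ≤ p * ℓ := Nat.mul_le_mul_right ℓ hp3
    omega
  have hroots := exists_listsRoots_cosetPoly_comp hℓ hlt hγ0 hγ
  set f := cosetPoly p ℓ γ with hf
  have hgdeg : (f.comp (X ^ ℓ)).natDegree = p * ℓ := by
    rw [natDegree_comp, natDegree_cosetPoly, natDegree_X_pow]
  have hg0 : f.comp (X ^ ℓ) ≠ 0 := (monic_cosetPoly.comp (monic_X_pow ℓ)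
    (by rwa [natDegree_X_pow])).ne_zero
  obtain ⟨β, hβ⟩ := exists_eval_ne_zero (mul_ne_zero hg0 (X_ne_zero (R := F)))
    (by rwa [natDegree_mul hg0 X_ne_zero, hgdeg, natDegree_X])
  rw [eval_mul, eval_X] at hβ
  have hβ0 := right_ne_zero_of_mul hβ
  have hβ := left_ne_zero_of_mul hβ
  have hder : ∀ x, (derivative (f.comp (X ^ ℓ))).eval x =
      ℓ * x ^ (ℓ - 1) * ((derivative f).comp (X ^ ℓ)).eval x := by
    intro x
    simp [derivative_comp, derivative_X_pow]
  have hℓF : (ℓ : F) ≠ 0 := by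
    intro h
    obtain ⟨α, hα⟩ := hroots
    apply hα.eval_derivative_ne_zero ⟨0, Nat.mul_pos hp.pos (Nat.pos_of_ne_zero hℓ0)⟩
    rw [hder, h, zero_mul, zero_mul]
  have hf'0 : ((derivative f).comp (X ^ ℓ)).eval 0 ≠ 0 := by
    rw [eval_comp, eval_pow, eval_X, zero_pow hℓ0]
    exact eval_zero_derivative_cosetPoly_ne_zero hp hγ0 hγ1
  have hf'ne : (derivative f).comp (X ^ ℓ) ≠ 0 := by
    intro h
    rw [h, eval_zero] at hf'0
    exact hf'0 rfl
  have hR : ((X - C β) ^ m : F[X]).Monic := (monic_X_sub_C β).pow m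
  have hadeg : (((X - C β) ^ m) ^ 2 * (derivative f).comp (X ^ ℓ)).natDegree =
      2 * m + (p - 2) * ℓ := by
    rw [natDegree_mul (pow_ne_zero 2 hR.ne_zero) hf'ne, natDegree_comp,
      natDegree_derivative_cosetPoly hp hγ0 hγ1, natDegree_X_pow, natDegree_pow, natDegree_pow,
      natDegree_X_sub_C, mul_one]
  have hsplit : p * ℓ = (p - 2) * ℓ + 2 * ℓ := by
    rw [← add_mul, Nat.sub_add_cancel hp.two_le]
  have hcop : IsCoprime (((X - C β) ^ m) ^ 2 * (derivative f).comp (X ^ ℓ))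
      (if Even ℓ then X else 1) := by
    split_ifs
    · rw [isCoprime_comm]
      have := isCoprime_X_sub_C_pow (β := 0)
        (b := ((X - C β) ^ m) ^ 2 * (derivative f).comp (X ^ ℓ)) (by
          rw [eval_mul]
          refine mul_ne_zero ?_ hf'0
          simp [hβ0]) 1
      rwa [C_0, sub_zero, pow_one] at this
    · exact isCoprime_one_right
  have hdeg : (((X - C β) ^ m) ^ 2 * (derivative f).comp (X ^ ℓ)).natDegree +
      (if Even ℓ then X else 1 : F[X]).natDegree ≤ p * ℓ := by
    rw [hadeg, hsplit]
    split_ifs with h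
    · have := heven h
      rw [natDegree_X]
      omega
    · have := hodd (Nat.not_even_iff_odd.1 h)
      rw [natDegree_one]
      omega
  obtain ⟨K, hK⟩ := exists_isObtainedFrom hroots hcop hdeg (inv_ne_zero hℓF) (fun x hx hx' => by
    rw [hder] at hx'
    have hf'x := right_ne_zero_of_mul hx'
    have hx0 : x ≠ 0 := by
      rintro rfl
      rw [eval_comp, eval_pow, eval_X, zero_pow hℓ0] at hx
      exact eval_zero_cosetPoly_ne_zero hγ0 hx
    have hxβ : x - β ≠ 0 := by
      rw [sub_ne_zero]
      rintro rfl
      exact hβ hx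
    -- The role of `b` is to make the exponent `ℓ - 1` coming from the chain rule even.
    have hpow : (if Even ℓ then X else 1 : F[X]).eval x * x ^ (ℓ - 1) = (x ^ (ℓ / 2)) ^ 2 := by
      rw [← pow_mul]
      split_ifs with h
      · rw [eval_X, ← pow_succ']
        rw [Nat.even_iff] at h
        congr 1
        omega
      · rw [eval_one, one_mul]
        rw [Nat.even_iff] at h
        congr 1
        omega
    refine ⟨(x - β) ^ m * ((derivative f).comp (X ^ ℓ)).eval x * x ^ (ℓ / 2),
      mul_ne_zero (mul_ne_zero (pow_ne_zero m hxβ) hf'x) (pow_ne_zero _ hx0), ?_⟩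
    rw [mul_pow, ← hpow, eval_mul, eval_mul, eval_mul, hder]
    simp only [eval_pow, eval_sub, eval_X, eval_C]
    field_simp)
  have h1 := (isObtainedFrom_spec hK).1
  rw [hadeg, show p * ℓ - (2 * m + (p - 2) * ℓ) = 2 * ℓ - 2 * m by omega] at h1
  refine ⟨K, h1, γ, (X - C β) ^ m, hγ, hR, ?_, hK⟩
  rw [natDegree_pow, natDegree_X_sub_C, mul_one]

end Cosets

/-! ### Shifted roots of unity: family 6. -/

section ShiftedRoots

theorem repNum_eq_sum {p : ℕ} (hp : 2 ≤ p) (t : ℕ) :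
    repNum p t = ∑ i ∈ Finset.range t, p ^ i := (Nat.geomSum_eq hp t).symm

theorem repNum_succ {p : ℕ} (hp : 2 ≤ p) (t : ℕ) : repNum p (t + 1) = p * repNum p t + 1 := by
  rw [repNum_eq_sum hp, repNum_eq_sum hp, Finset.sum_range_succ', Finset.mul_sum, pow_zero]
  simp only [pow_succ']

theorem sub_one_mul_repNum {p : ℕ} (hp : 2 ≤ p) (t : ℕ) :
    (p - 1) * repNum p t + 1 = p ^ t := by
  obtain ⟨d, rfl⟩ := Nat.exists_eq_add_of_le' hp
  induction t with
  | zero => simp [repNum]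
  | succ t ih =>
    rw [repNum_succ hp, pow_succ, ← ih, show d + 2 - 1 = d + 1 by omega]
    ring

variable {F : Type*} [Field F]

theorem X_mul_shiftedRootPoly (N : ℕ) : X * shiftedRootPoly F N = (X + 1) ^ N - 1 := by
  have h := divX_mul_X_add ((X + 1) ^ N - 1 : F[X])
  rw [coeff_zero_eq_eval_zero] at h
  simp only [eval_sub, eval_pow, eval_add, eval_X, eval_one, zero_add, one_pow, sub_self, C_0,
    add_zero] at h
  rw [mul_comm]
  exact h

theorem monic_shiftedRootPoly {N : ℕ} (hN : 0 < N) : (shiftedRootPoly F N).Monic := by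
  refine Monic.of_mul_monic_left (monic_X (R := F)) ?_
  have h := (monic_X_pow_sub_C (1 : F) hN.ne').comp_X_add_C 1
  rw [X_mul_shiftedRootPoly]
  simpa [sub_comp] using h

theorem natDegree_shiftedRootPoly {N : ℕ} (hN : 0 < N) :
    (shiftedRootPoly F N).natDegree = N - 1 := by
  have h : (X * shiftedRootPoly F N).natDegree = N := by
    have h1 : ((X ^ N - C 1 : F[X]).comp (X + C 1)).natDegree = N := by
      rw [natDegree_comp, natDegree_X_add_C, mul_one, natDegree_X_pow_sub_C]
    rw [X_mul_shiftedRootPoly]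
    simpa [sub_comp] using h1
  rw [natDegree_mul X_ne_zero (monic_shiftedRootPoly hN).ne_zero, natDegree_X] at h
  omega

theorem eval_shiftedRootPoly_add_derivative (N : ℕ) (x : F) :
    (shiftedRootPoly F N).eval x + x * (derivative (shiftedRootPoly F N)).eval x =
      N * (x + 1) ^ (N - 1) := by
  have h := congrArg (fun P => (derivative P).eval x) (X_mul_shiftedRootPoly (F := F) N)
  simpa [derivative_pow] using h

theorem mul_eval_shiftedRootPoly (N : ℕ) (x : F) :
    x * (shiftedRootPoly F N).eval x = (x + 1) ^ N - 1 := by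
  have h := congrArg (eval x) (X_mul_shiftedRootPoly (F := F) N)
  simpa using h

theorem eval_zero_shiftedRootPoly (N : ℕ) : (shiftedRootPoly F N).eval 0 = N := by
  simpa using eval_shiftedRootPoly_add_derivative (F := F) N 0

theorem exists_listsRoots_shiftedRootPoly [Fintype F] {N n : ℕ} (hn : N = n + 1)
    (hN : N ∣ Fintype.card F - 1) :
    ∃ α : Fin n → F, ListsRoots α (shiftedRootPoly F N) := by
  refine exists_listsRoots_of_dvd (monic_shiftedRootPoly (by omega)) ?_ ?_
  · rw [natDegree_shiftedRootPoly (by omega), hn, Nat.add_sub_cancel]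
  · have h := map_dvd (compRingHom (X + C 1)) (X_pow_sub_one_dvd_X_pow_card_sub_X (F := F) hN)
    rw [coe_compRingHom_apply, coe_compRingHom_apply, X_pow_card_sub_X_comp_X_add_C, sub_comp,
      X_pow_comp, one_comp, C_1, ← X_mul_shiftedRootPoly] at h
    exact (dvd_mul_left _ _).trans h

/-- Put `y = x + 1` and `u = y^N - 1 = x h(x)`. Then `y^M = 1` gives `g'(x) = 1/(x y)`, and the
Frobenius gives `u^p = y^(pN) - 1 = y⁻¹ - 1`, that is `x = -y u^p`. Hence `-x h g' = y⁻² u^(1-p)`, a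
square because `p - 1` is even. -/
theorem exists_sq_eq_shiftedRootPoly {p N M : ℕ} [CharP F p] (hp : p.Prime) (hp2 : p ≠ 2)
    (hMN : M = p * N + 1) {x : F} (hx : (shiftedRootPoly F M).eval x = 0) :
    ∃ s : F, s ≠ 0 ∧ s ^ 2 = -(x * (shiftedRootPoly F N).eval x *
      (derivative (shiftedRootPoly F M)).eval x) := by
  have : Fact p.Prime := ⟨hp⟩
  have hpF : (p : F) = 0 := CharP.cast_eq_zero F p
  obtain ⟨i, hi⟩ := hp.odd_of_ne_two hp2
  have hMF : (M : F) = 1 := by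
    rw [hMN, Nat.cast_add_one, Nat.cast_mul, hpF, zero_mul, zero_add]
  have hx0 : x ≠ 0 := by
    rintro rfl
    rw [eval_zero_shiftedRootPoly, hMF] at hx
    exact one_ne_zero hx
  have h1 := mul_eval_shiftedRootPoly (F := F) M x
  have h2 := eval_shiftedRootPoly_add_derivative (F := F) M x
  rw [hx, mul_zero] at h1
  rw [hx, zero_add, hMF, one_mul, show M - 1 = p * N by omega] at h2
  set y := x + 1 with hy
  have hyM : y ^ (p * N) * y = 1 := by
    rw [← pow_succ, ← hMN]
    exact (sub_eq_zero.1 h1.symm)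
  have hy0 : y ≠ 0 := right_ne_zero_of_mul (by rw [hyM]; exact one_ne_zero)
  rw [mul_eval_shiftedRootPoly]
  set u := y ^ N - 1 with hu
  have hup : u ^ p = y ^ (p * N) - 1 := by
    rw [hu, sub_pow_char, one_pow, ← pow_mul, mul_comm]
  have hxu : x = -(y * u ^ p) := by
    rw [hup]
    linear_combination hyM + hy
  have hu0 : u ≠ 0 := by
    intro h
    rw [h, zero_pow hp.ne_zero, mul_zero, neg_zero] at hxu
    exact hx0 hxu
  refine ⟨y⁻¹ * (u ^ i)⁻¹, mul_ne_zero (inv_ne_zero hy0) (inv_ne_zero (pow_ne_zero i hu0)), ?_⟩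
  have h3 : (derivative (shiftedRootPoly F M)).eval x = y⁻¹ / x := by
    rw [eq_div_iff hx0, mul_comm, h2, ← one_div, eq_div_iff hy0, hyM]
  rw [h3, hxu, hi]
  field_simp
  ring

theorem exists_isObtainedFrom_shiftedRootPoly [Fintype F] {p N M : ℕ} [CharP F p] (hp : p.Prime)
    (hp2 : p ≠ 2) (hN : (N : F) = 1) (hMN : M = p * N + 1)
    (hM : (p - 1) * M + 1 = Fintype.card F) {m : ℕ} (hm : 2 * m + N ≤ p * N) :
    ∃ R : F[X], R.Monic ∧ R.natDegree = m ∧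
      (∃ K : Submodule F (Fin (p * N) → F), IsObtainedFrom (shiftedRootPoly F M) (R ^ 2)
        (X * shiftedRootPoly F N) K) ∧
      (∃ K : Submodule F (Fin (p * N) → F), IsObtainedFrom (shiftedRootPoly F M) (R ^ 2 * X)
        (shiftedRootPoly F N) K) := by
  have hN0 : 0 < N := by
    rcases Nat.eq_zero_or_pos N with rfl | h
    · rw [Nat.cast_zero] at hN
      exact absurd hN zero_ne_one
    · exact h
  have hp3 : 3 ≤ p := by
    have := hp.two_le
    omega
  have hM0 : 0 < M := by omega
  have hNM : N < M := by
    have : 3 * N ≤ p * N := Nat.mul_le_mul_right N hp3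
    omega
  have hcard : 2 * M + 1 ≤ Fintype.card F := by
    rw [← hM]
    exact Nat.succ_le_succ (Nat.mul_le_mul_right M (by omega))
  have hh0 := (monic_shiftedRootPoly (F := F) hN0).ne_zero
  have hg0 := (monic_shiftedRootPoly (F := F) hM0).ne_zero
  have hb0 := mul_ne_zero (X_ne_zero (R := F)) hh0
  have hbdeg : (X * shiftedRootPoly F N).natDegree = N := by
    rw [natDegree_mul X_ne_zero hh0, natDegree_X, natDegree_shiftedRootPoly hN0]
    omega
  obtain ⟨β, hβ⟩ := exists_eval_ne_zero (mul_ne_zero hb0 hg0) (by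
    rw [natDegree_mul hb0 hg0, hbdeg, natDegree_shiftedRootPoly hM0]
    omega)
  rw [eval_mul] at hβ
  have hβb := left_ne_zero_of_mul hβ
  have hβg := right_ne_zero_of_mul hβ
  have hroots := exists_listsRoots_shiftedRootPoly (F := F) hMN
    (show M ∣ Fintype.card F - 1 by rw [← hM, Nat.add_sub_cancel]; exact dvd_mul_left _ _)
  have hR : ((X - C β) ^ m : F[X]).Monic := (monic_X_sub_C β).pow m
  have hRdeg : ((X - C β) ^ m : F[X]).natDegree = m := by
    rw [natDegree_pow, natDegree_X_sub_C, mul_one]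
  -- Only the product `a b` matters here, so the factor `x` may be placed in either; this choice
  -- controls the parity of `deg a`.
  have hsq : ∀ a b : F[X], a * b = ((X - C β) ^ m) ^ 2 * (X * shiftedRootPoly F N) →
      ∀ x, (shiftedRootPoly F M).eval x = 0 → ∃ s : F, s ≠ 0 ∧
        s ^ 2 = -1 * (a * b * derivative (shiftedRootPoly F M)).eval x := by
    intro a b hab x hx
    obtain ⟨s, hs, hs'⟩ := exists_sq_eq_shiftedRootPoly hp hp2 hMN hx
    have hxβ : x - β ≠ 0 := by
      rw [sub_ne_zero]
      rintro rfl
      exact hβg hx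
    refine ⟨(x - β) ^ m * s, mul_ne_zero (pow_ne_zero m hxβ) hs, ?_⟩
    rw [mul_pow, hs', hab]
    simp only [eval_mul, eval_pow, eval_sub, eval_X, eval_C]
    ring
  refine ⟨_, hR, hRdeg, ?_, ?_⟩
  · refine exists_isObtainedFrom hroots ((isCoprime_X_sub_C_pow hβb m).pow_left) ?_
      (neg_ne_zero.2 one_ne_zero) fun x hx _ => hsq _ _ rfl x hx
    rw [natDegree_pow, hRdeg, hbdeg]
    exact hm
  · refine exists_isObtainedFrom hroots (IsCoprime.mul_left ?_ ?_) ?_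
      (neg_ne_zero.2 one_ne_zero) fun x hx _ => hsq _ _ (mul_assoc _ _ _) x hx
    · rw [eval_mul] at hβb
      exact (isCoprime_X_sub_C_pow (right_ne_zero_of_mul hβb) m).pow_left
    · have := isCoprime_X_sub_C_pow (β := 0) (b := shiftedRootPoly F N)
        (by rw [eval_zero_shiftedRootPoly, hN]; exact one_ne_zero) 1
      rwa [C_0, sub_zero, pow_one] at this
    · rw [natDegree_mul_X (pow_ne_zero 2 hR.ne_zero), natDegree_pow, hRdeg,
        natDegree_shiftedRootPoly hN0]
      omega

theorem exists_isLCDMDS_shiftedRootPoly [Fintype F] {p N M : ℕ} [CharP F p] (hp : p.Prime)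
    (hp2 : p ≠ 2) (hN : (N : F) = 1) (hMN : M = p * N + 1)
    (hM : (p - 1) * M + 1 = Fintype.card F) {k : ℕ} (hk : k ≤ p * N) :
    ∃ K : Submodule F (Fin (p * N) → F), IsLCDMDS k K ∧
      ∃ R : F[X], R.Monic ∧
        (IsObtainedUpToDual (shiftedRootPoly F M) (R ^ 2) (X * shiftedRootPoly F N) K ∨
          IsObtainedUpToDual (shiftedRootPoly F M) (R ^ 2 * X) (shiftedRootPoly F N) K) := by
  obtain ⟨i, hi⟩ := hp.odd_of_ne_two hp2
  have hi0 : 1 ≤ i := by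
    have := hp.two_le
    omega
  have hiN : N ≤ i * N := Nat.le_mul_of_pos_left N hi0
  have hn : p * N = 2 * (i * N) + N := by
    rw [hi]
    ring
  have key : ∀ m, m ≤ i * N → ∃ R : F[X], R.Monic ∧
      (∃ K : Submodule F (Fin (p * N) → F), IsObtainedFrom (shiftedRootPoly F M) (R ^ 2)
        (X * shiftedRootPoly F N) K ∧ IsLCDMDS (p * N - 2 * m) K ∧
        IsLCDMDS (2 * m) (dualCode K) ∧ dualCode (dualCode K) = K) ∧
      (∃ K : Submodule F (Fin (p * N) → F), IsObtainedFrom (shiftedRootPoly F M) (R ^ 2 * X)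
        (shiftedRootPoly F N) K ∧ IsLCDMDS (p * N - (2 * m + 1)) K ∧
        IsLCDMDS (2 * m + 1) (dualCode K) ∧ dualCode (dualCode K) = K) := by
    intro m hm
    obtain ⟨R, hR, hRdeg, ⟨K, hK⟩, ⟨K', hK'⟩⟩ :=
      exists_isObtainedFrom_shiftedRootPoly hp hp2 hN hMN hM (m := m) (by omega)
    obtain ⟨h1, h2, h3, -⟩ := isObtainedFrom_spec hK
    obtain ⟨h1', h2', h3', -⟩ := isObtainedFrom_spec hK'
    rw [natDegree_pow, hRdeg] at h1 h2
    rw [natDegree_mul_X (pow_ne_zero 2 hR.ne_zero), natDegree_pow, hRdeg] at h1' h2'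
    exact ⟨R, hR, ⟨K, hK, h1, h2, h3⟩, ⟨K', hK', h1', h2', h3'⟩⟩
  -- The construction reaches every `deg a` from `0` to `2 i N + 1`. A small `k` is `deg a` and
  -- comes from a dual code; otherwise `n - k` is small and is `deg a`.
  by_cases hsmall : k / 2 ≤ i * N
  · obtain ⟨R, hR, ⟨K, hK, -, h2, h3⟩, ⟨K', hK', -, h2', h3'⟩⟩ := key (k / 2) hsmall
    rcases Nat.mod_two_eq_zero_or_one k with h | h
    · rw [show 2 * (k / 2) = k by omega] at h2
      exact ⟨dualCode K, h2, R, hR, Or.inl (Or.inr (by rwa [h3]))⟩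
    · rw [show 2 * (k / 2) + 1 = k by omega] at h2'
      exact ⟨dualCode K', h2', R, hR, Or.inr (Or.inr (by rwa [h3']))⟩
  · obtain ⟨R, hR, ⟨K, hK, h1, -⟩, ⟨K', hK', h1', -⟩⟩ := key ((p * N - k) / 2) (by omega)
    rcases Nat.mod_two_eq_zero_or_one (p * N - k) with h | h
    · rw [show p * N - 2 * ((p * N - k) / 2) = k by omega] at h1
      exact ⟨K, h1, R, hR, Or.inl (Or.inl hK)⟩
    · rw [show p * N - (2 * ((p * N - k) / 2) + 1) = k by omega] at h1'
      exact ⟨K', h1', R, hR, Or.inr (Or.inl hK')⟩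

end ShiftedRoots

/-! ### Assembly of the seven families. -/

theorem mainTheorem1 {F : Type*} [Field F] [Fintype F] (p r : ℕ) (hp : p.Prime) (hp2 : p ≠ 2)
    (hF : Fintype.card F = p ^ r) :
    -- additive subgroups as evaluation sets: `n = p ^ t`
    (∀ t k : ℕ, 1 ≤ t → t < r → k ≤ p ^ t →
      ∃ K : Submodule F (Fin (p ^ t) → F), IsLCDMDS k K ∧
        ∃ V : AddSubgroup F, Nat.card V = p ^ t ∧
          ∃ R : F[X], R.Monic ∧ IsObtainedUpToDual (subspacePoly V) (R ^ 2) 1 K) ∧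
    -- `p` divides `n` and `n - 1` divides `q - 1`
    (∀ n k : ℕ, 0 < n → n < p ^ r → p ∣ n → (n - 1) ∣ (p ^ r - 1) → k ≤ n →
      ∃ K : Submodule F (Fin n → F), IsLCDMDS k K ∧
        (∃ α v : Fin n → F, ListsRoots α (X ^ n - X) ∧ (∀ i, v i ≠ 0) ∧ K = grsCode α v k) ∧
        (Odd n ∨ Even k →
          ∃ R : F[X], R.Monic ∧ IsObtainedUpToDual (X ^ n - X) (R ^ 2) 1 K)) ∧
    -- unions of `p` cosets of the group of `ℓ`-th roots of unity: `n = p ℓ`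
    (∀ ℓ m : ℕ, ℓ ∣ (p ^ r - 1) → p * ℓ < p ^ r →
      (Even ℓ → m ≤ ℓ - 1) → (Odd ℓ → m ≤ ℓ) →
      ∃ K : Submodule F (Fin (p * ℓ) → F), IsLCDMDS (2 * ℓ - 2 * m) K ∧
        ∃ (γ : F) (R : F[X]), orderOf γ = p ^ r - 1 ∧ R.Monic ∧ R.natDegree = m ∧
          IsObtainedFrom ((cosetPoly p ℓ γ).comp (X ^ ℓ))
            (R ^ 2 * (derivative (cosetPoly p ℓ γ)).comp (X ^ ℓ))
            (if Even ℓ then X else 1) K) ∧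
    -- `q` is a square and `n - 1` is an odd divisor of `q - 1`
    (5 ≤ p ^ r → IsSquare (p ^ r) → ∀ n m : ℕ, n < p ^ r → Odd (n - 1) →
      (n - 1) ∣ (p ^ r - 1) → 2 * m ≤ n →
      ∃ K : Submodule F (Fin n → F), IsLCDMDS (n - 2 * m) K ∧
        ∃ β γ : F, β ≠ γ ∧
          IsObtainedFrom (X ^ n - X) ((X - C β) ^ (2 * m)) ((X - C γ) ^ (n - 2 * m)) K) ∧
    -- `n` divides `(q - 1) / 2`
    (∀ n m : ℕ, n ∣ (p ^ r - 1) / 2 → 1 ≤ m → 2 * m ≤ n →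
      (Even n → ∃ K : Submodule F (Fin n → F), IsLCDMDS (n - 2 * m) K ∧
        ∃ β γ : F, β ≠ γ ∧
          IsObtainedFrom (X ^ n - 1) (C (n : F) * (X - C β) ^ (2 * m))
            ((X - C γ) ^ (n - 2 * m)) K) ∧
      (Odd n → ∃ K : Submodule F (Fin n → F), IsLCDMDS (n - 2 * m - 1) K ∧
        ∃ β γ : F, β ≠ γ ∧
          IsObtainedFrom (X ^ n - 1) (C (n : F) * X * (X - C β) ^ (2 * m))
            ((X - C γ) ^ (n - 1 - 2 * m)) K)) ∧
    -- `n = p N_{r-1}`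
    (1 < r → ∀ k : ℕ, k ≤ p * repNum p (r - 1) →
      ∃ K : Submodule F (Fin (p * repNum p (r - 1)) → F), IsLCDMDS k K ∧
        ∃ R : F[X], R.Monic ∧
          (IsObtainedUpToDual (shiftedRootPoly F (repNum p r)) (R ^ 2)
              (X * shiftedRootPoly F (repNum p (r - 1))) K ∨
            IsObtainedUpToDual (shiftedRootPoly F (repNum p r)) (R ^ 2 * X)
              (shiftedRootPoly F (repNum p (r - 1))) K)) ∧
    -- unions of `d` cosets of a subspace: `n = d p ^ t`
    (∀ t d m : ℕ, t < r → 1 ≤ d → d ≤ p ^ (r - t) → Nat.gcd d p = 1 → 2 ≤ m → 2 * m ≤ p ^ t →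
      ∃ K : Submodule F (Fin (d * p ^ t) → F), IsLCDMDS (d * p ^ t - 2 * m) K ∧
        ∃ (V : AddSubgroup F) (B : Finset F) (R : F[X]), Nat.card V = p ^ t ∧ B.card = d ∧
          (∀ x ∈ B, ∀ y ∈ B, x - y ∈ V → x = y) ∧ R.Monic ∧ R.natDegree = m ∧
          IsObtainedFrom
            ((∏ x ∈ B, (X - C ((subspacePoly V).eval x))).comp (subspacePoly V)) (R ^ 2)
            ((derivative (∏ x ∈ B, (X - C ((subspacePoly V).eval x)))).comp (subspacePoly V))
            K) := by
  have : Fact p.Prime := ⟨hp⟩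
  have hchar : CharP F p := charP_of_card_eq_prime_pow hF
  refine ⟨?_, ?_, ?_, ?_, ?_, ?_, ?_⟩
  · intro t k _ htr hk
    refine exists_isLCDMDS_subspacePoly hp hp2 ?_ ?_ hk <;> rw [hF]
    · exact pow_dvd_pow p htr.le
    · exact Nat.pow_lt_pow_right hp.one_lt htr
  · intro n k hn0 hn hpn hdvd hk
    rw [← hF] at hn hdvd
    exact exists_isLCDMDS_X_pow_sub_X hp hp2 hn0 hn hpn hdvd hk
  · intro ℓ m hℓ hlt heven hodd
    rw [← hF] at hℓ hlt ⊢
    exact exists_isLCDMDS_cosetPoly hp hp2 hℓ hlt heven hodd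
  · intro hq5 hsq n m hn hodd hdvd hm
    obtain ⟨s, hs⟩ := hsq
    obtain ⟨j, -, rfl⟩ := (Nat.dvd_prime_pow hp).1 (Dvd.intro s hs.symm)
    refine exists_isLCDMDS_of_isSquare_card hp hp2 (s := p ^ j) (by rw [hF, hs, sq]) ?_ ?_ hodd
      (by rwa [hF]) hm
    · simpa using Nat.sub_dvd_pow_sub_pow p 1 j
    · rw [hF]
      -- If `n = q - 1`, then `q - 2` would divide `q - 1`, which is impossible for `q ≥ 5`.
      refine lt_of_le_of_ne hn fun h => ?_
      obtain ⟨c, hc⟩ := hdvd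
      have hc1 : c ≠ 1 := by
        rintro rfl
        omega
      have hc0 : c ≠ 0 := by
        rintro rfl
        omega
      have : (n - 1) * 2 ≤ (n - 1) * c := Nat.mul_le_mul_left _ (by omega)
      omega
  · intro n m hdvd hm1 hm
    rw [← hF] at hdvd
    exact exists_isLCDMDS_X_pow_sub_one hp2 hdvd hm1 hm
  · intro hr k hk
    -- Since `r - 1 ≥ 1`, the recursion for `repNum` gives `N_{r-1} ≡ 1` modulo `p`.
    obtain ⟨t, rfl⟩ : ∃ t, r = t + 2 := ⟨r - 2, by omega⟩
    rw [show t + 2 - 1 = t + 1 by omega] at hk ⊢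
    refine exists_isLCDMDS_shiftedRootPoly hp hp2 ?_ (repNum_succ hp.two_le (t + 1)) ?_ hk
    · rw [repNum_succ hp.two_le, Nat.cast_add_one, Nat.cast_mul, CharP.cast_eq_zero, zero_mul,
        zero_add]
    · rw [hF, sub_one_mul_repNum hp.two_le]
  · intro t d m htr hd hdle _ hm hmt
    refine exists_isLCDMDS_comp_subspacePoly hp ?_ hd ?_ hm hmt <;> rw [hF]
    · exact pow_dvd_pow p htr.le
    · rw [← Nat.sub_add_cancel htr.le, pow_add]
      exact Nat.mul_le_mul_right _ hdle
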